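/- Let $\mathcal M=(S,Act,\mathbf P,s_I,\rho)$ be a Markov decision process: $S$ and $Act$ are finite, $s_I\in S$, $\mathbf P\colon S\times Act\times S\to[0,1]$ with $\sum_{s'}\mathbf P(s,\alpha,s')\in\{0,1\}$, $\rho\colon S\times Act\to\mathbb R$ is a reward function (which plays no role here), and $Act(s)=\{\alpha\mid\sum_{s'}\mathbf P(s,\alpha,s')=1\}\neq\emptyset$ for every $s\in S$. Let $G\subseteq S$ be a set of absorbing states, i.e. $\mathbf P(s,\alpha,s)=1$ for all $s\in G$, $\alpha\in Act(s)$. A (deterministic, history dependent) scheduler $\sigma$ maps each finite path to an action enabled in its last state; $\mathrm{Pr}^\sigma_s$ is the induced probability measure on the infinite paths from $s$, $\lozenge T$ is the set of paths that visit $T\subseteq S$, $\mathrm{Pr}^{\max}_s(\lozenge G)=\max_\sigma\mathrm{Pr}^\sigma_s(\lozenge G)$, and $\mathrm{Pr}^{\max}(\lozenge G)=\mathrm{Pr}^{\max}_{s_I}(\lozenge G)$. Let $S_0=\{s\mid\mathrm{Pr}^{\max}_s(\lozenge G)=0\}$ and $S_?=S\setminus(S_0\cup G)$. Assume that $\mathcal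 M$ is contracting with respect to $G\cup S_0$, i.e. $\mathrm{Pr}^\sigma_s(\lozenge(G\cup S_0))=1$ for all $s\in S$ and all schedulers $\sigma$, and let $\varepsilon>0$. Consider the following algorithm (sound value iteration for MDPs), with exact real arithmetic for the vectors and extended real values for the bounds. Start with $x_0=1$ on $G$ and $0$ elsewhere, $y_0=1$ on $S_?$ and $0$ elsewhere, $\ell_0=-\infty$, $u_0=+\infty$, $d_0=-\infty$. For $k=1,2,\dots$ do: 1. For each $s\in S_?$ let $\alpha_s$ be the result of $\mathit{findAction}(x_{k-1},y_{k-1},s,u_{k-1})$. 2. Set $x_k[s]=\sum_{s'}\mathbf P(s,\alpha_s,s')\,x_{k-1}[s']$ and $y_k[s]=\sum_{s'}\mathbf P(s,\alpha_s,s')\,y_{k-1}[s']$ for $s\in S_?$, with $x_k=1$ on $G$, $x_k=0$ on $S_0$, and $y_k=0$ on $S\setminus S_?$. 3. Set $d_k=\max\bigl(d_{k-1},\max_{s\in S_?}\mathit{decisionValue}(x_{k-1},y_{k-1},s,\alpha_s)\bigr)$. 4. If $y_k[s]<1$ for all $s\in S_?$, set $\ell_k=\max\bigl(\ell_{k-1},\min_{s\in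 S_?}\frac{x_k[s]}{1-y_k[s]}\bigr)$ and $u_k=\min\bigl(u_{k-1},\max(d_k,\max_{s\in S_?}\frac{x_k[s]}{1-y_k[s]})\bigr)$; otherwise $\ell_k=\ell_{k-1}$ and $u_k=u_{k-1}$. 5. If $y_k[s_I]\cdot(u_k-\ell_k)<2\varepsilon$, stop and return $r=x_k[s_I]+y_k[s_I]\cdot\frac{\ell_k+u_k}{2}$. Here products with the factor $0$ are $0$, even if the other factor is infinite or is the undefined expression $-\infty+\infty$; the minimum of the empty set is $+\infty$ and its maximum $-\infty$. The function $\mathit{findAction}(x,y,s,u)$ returns, for real $u$, an arbitrary maximizer over $\alpha\in Act(s)$ of $\sum_{s'}\mathbf P(s,\alpha,s')\,(x[s']+y[s']\,u)$; for $u=+\infty$ it returns an action that maximizes this expression for all sufficiently large real $u$, that is, a maximizer of $\sum_{s'}\mathbf P(s,\alpha,s')\,y[s']$ which, among these maximizers, maximizes $\sum_{s'}\mathbf P(s,\alpha,s')\,x[s']$. The value $\mathit{decisionValue}(x,y,s,\alpha)$ is the maximum of $$\frac{\sum_{s'}(\mathbf P(s,\beta,s')-\mathbf P(s,\alpha,s'))\,x[s']}{\sum_{s'}(\mathbf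 P(s,\alpha,s')-\mathbf P(s,\beta,s'))\,y[s']}$$ over all $\beta\in Act(s)\setminus\{\alpha\}$ with positive denominator, and $-\infty$ if there is no such $\beta$. Then, however $\mathit{findAction}$ resolves its remaining choices, the algorithm terminates, and the returned value $r$ is a real number with $|r-\mathrm{Pr}^{\max}(\lozenge G)|\le\varepsilon$. -/

import Mathlib

open MeasureTheory ProbabilityTheory

/-- A Markov decision process with (finite) state space `S` and action set `A`. -/
structure MDP (S A : Type*) [Fintype S] where
  /-- the transition probabilities `P(s, α, s')` -/
  P : S → A → S → ℝ
  /-- the initial state -/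
  init : S
  /-- the reward function -/
  reward : S → A → ℝ
  P_nonneg : ∀ s a s', 0 ≤ P s a s'
  P_sum : ∀ s a, ∑ s', P s a s' = 0 ∨ ∑ s', P s a s' = 1
  exists_enabled : ∀ s, ∃ a, ∑ s', P s a s' = 1

namespace MDP

/-! ### Paths, schedulers, reachability probabilities -/

section Model

variable {S A : Type*} [Fintype S] (M : MDP S A)

/-- The set `Act(s)` of actions that are enabled in the state `s`. -/
def Act (s : S) : Set A := {a | ∑ s', M.P s a s' = 1}

/-- All enabled actions loop with probability one. -/
def IsAbsorbing (s : S) : Prop := ∀ a ∈ M.Act s, M.P s a s = 1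

/-- A state together with an action that is enabled there. An infinite path `s₀ α₀ s₁ α₁ …` is a
sequence `ℕ → M.Move`. (Sequences with a transition of probability zero are not excluded here;
they form a null set for each of the path measures below.) -/
def Move : Type _ := {p : S × A // p.2 ∈ M.Act p.1}

/-- The state component `s` of `(s, α)`. -/
def Move.state {M : MDP S A} (p : M.Move) : S := p.1.1

/-- The action component `α` of `(s, α)`. -/
def Move.action {M : MDP S A} (p : M.Move) : A := p.1.2

instance : MeasurableSpace M.Move := ⊤

instance : DiscreteMeasurableSpace M.Move := ⟨fun _ => trivial⟩

instance [Finite A] : Finite M.Move := by unfold Move; infer_instance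

/-- A deterministic (history dependent) scheduler. The finite path `s₀ α₀ … αₙ₋₁ sₙ` is given by
the list `[(s₀, α₀), …, (sₙ₋₁, αₙ₋₁)]` and its last state `sₙ`. -/
structure Scheduler where
  act : List M.Move → S → A
  enabled : ∀ h s, act h s ∈ M.Act s

variable {M}

/-- The state `s`, reached with the past `h`, together with the action that `σ` selects there. -/
def Scheduler.move (σ : M.Scheduler) (h : List M.Move) (s : S) : M.Move :=
  ⟨(s, σ.act h s), σ.enabled h s⟩

/-- The distribution of the next state (with the action selected there) if `(s, α) = p` is the
last entry of the past `h`: the state `s'` has probability `P(s, α, s')`. -/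
noncomputable def Scheduler.next (σ : M.Scheduler) (h : List M.Move) (p : M.Move) :
    Measure M.Move :=
  ∑ s', ENNReal.ofReal (M.P p.state p.action s') • Measure.dirac (σ.move h s')

instance (σ : M.Scheduler) (h : List M.Move) (p : M.Move) :
    IsProbabilityMeasure (σ.next h p) := by
  constructor
  have hp : ∑ s', M.P p.state p.action s' = 1 := p.2
  simp only [Scheduler.next, Measure.coe_finsetSum, Measure.coe_smul, Finset.sum_apply,
    Pi.smul_apply, measure_univ, smul_eq_mul, mul_one]
  rw [← ENNReal.ofReal_sum_of_nonneg fun s' _ => M.P_nonneg _ _ _, hp, ENNReal.ofReal_one]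

/-- The first `n + 1` entries of a path, as a list. -/
def pastList (n : ℕ) (w : Finset.Iic n → M.Move) : List M.Move :=
  List.ofFn fun i : Fin (n + 1) => w ⟨i, Finset.mem_Iic.2 (Nat.lt_succ_iff.1 i.2)⟩

/-- The transition kernel from the first `n + 1` entries of a path to the next one. -/
noncomputable def Scheduler.kernel [Finite A] (σ : M.Scheduler) (n : ℕ) :
    Kernel (Finset.Iic n → M.Move) M.Move :=
  Kernel.ofFunOfCountable fun w =>
    σ.next (pastList n w) (w ⟨n, Finset.mem_Iic.2 le_rfl⟩)

instance [Finite A] (σ : M.Scheduler) (n : ℕ) : IsMarkovKernel (σ.kernel n) :=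
  ⟨fun w => by
    change IsProbabilityMeasure (σ.next _ _)
    infer_instance⟩

/-- The probability measure on infinite paths that start in `s`, under the scheduler `σ`. -/
noncomputable def Scheduler.pathMeasure [Finite A] (σ : M.Scheduler) (s : S) :
    Measure (ℕ → M.Move) :=
  Kernel.traj (X := fun _ => M.Move) σ.kernel 0 (fun _ => σ.move [] s)

variable (M)

/-- The set `◇ G` of the infinite paths that visit `G`. -/
def reach (G : Set S) : Set (ℕ → M.Move) := {w | ∃ j, (w j).state ∈ G}

/-- The reachability probability of `G` from `s` under `σ`. -/
noncomputable def reachProb [Finite A] (σ : M.Scheduler) (s : S) (G : Set S) : ℝ :=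
  (σ.pathMeasure s).real (M.reach G)

/-- The maximal reachability probability of `G` from `s`. -/
noncomputable def maxReachProb [Finite A] (s : S) (G : Set S) : ℝ :=
  ⨆ σ : M.Scheduler, M.reachProb σ s G

/-- `M` is contracting with respect to `T`. -/
def IsContracting [Finite A] (T : Set S) : Prop :=
  ∀ (s : S) (σ : M.Scheduler), M.reachProb σ s T = 1

/-- The set `S₀` of the states from which `G` is reached with maximal probability zero. -/
def zeroStates [Finite A] (G : Set S) : Set S := {s | M.maxReachProb s G = 0}

end Model

/-! ### Sound value iteration for MDPs -/

/-- The maximizers of `f` on `T`. -/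
def argmax {A : Type*} (T : Set A) (f : A → ℝ) : Set A := {a | a ∈ T ∧ ∀ b ∈ T, f b ≤ f a}

/-- The values of the program variables `x_k, y_k, ℓ_k, u_k, d_k`. -/
structure Vars (S : Type*) where
  x : S → ℝ
  y : S → ℝ
  l : EReal
  u : EReal
  d : EReal

/-- A configuration of the program: at the head of the loop, or stopped with a returned value. -/
inductive Config (S : Type*) where
  | running (c : Vars S)
  | returned (r : EReal)

section Algorithm

variable {S A : Type*} [Fintype S] [Fintype A] (M : MDP S A) (G : Set S)

/-- `∑_{s'} P(s, α, s') · z[s']` -/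
def expect (s : S) (a : A) (z : S → ℝ) : ℝ := ∑ s', M.P s a s' * z s'

open Classical in
/-- The actions that `findAction(x, y, s, u)` may return. For a real number `u` these are the
maximizers of `∑_{s'} P(s, α, s') · (x[s'] + y[s'] · u)`. The value `u = ∞` stands for a
sufficiently large real number: one maximizes `∑_{s'} P(s, α, s') · y[s']`, and among the
maximizers `∑_{s'} P(s, α, s') · x[s']`. -/
noncomputable def findAction (x y : S → ℝ) (s : S) (u : EReal) : Set A :=
  if u ≠ ⊤ then argmax (M.Act s) fun a => M.expect s a fun s' => x s' + y s' * u.toReal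
  else argmax (argmax (M.Act s) fun a => M.expect s a y) fun a => M.expect s a x

/-- The case `u = ∞` of `findAction` agrees with the real case for all sufficiently large `u`. -/
theorem mem_findAction_top_iff (x y : S → ℝ) (s : S) (a : A) :
    a ∈ M.findAction x y s ⊤ ↔ ∀ᶠ v : ℝ in Filter.atTop, a ∈ M.findAction x y s (v : EReal) := by
  have key : ∀ (b : A) (v : ℝ), M.expect s b (fun s' => x s' + y s' * v) =
      M.expect s b x + M.expect s b y * v := fun b v => by
    simp only [expect, mul_add, Finset.sum_add_distrib, Finset.sum_mul, mul_assoc]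
  simp only [findAction, ne_eq, EReal.coe_ne_top, not_false_eq_true, if_true, not_true_eq_false,
    if_false, EReal.toReal_coe, argmax, Set.mem_ofPred_eq, key]
  constructor
  · rintro ⟨⟨ha, hy⟩, hx⟩
    have : ∀ b : A, ∀ᶠ v : ℝ in Filter.atTop, b ∈ M.Act s →
        M.expect s b x + M.expect s b y * v ≤ M.expect s a x + M.expect s a y * v := by
      intro b
      by_cases hb : b ∈ M.Act s
      · rcases (hy b hb).lt_or_eq with h | h
        · have hpos : 0 < M.expect s a y - M.expect s b y := by linarith
          filter_upwards [Filter.eventually_ge_atTop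
            ((M.expect s b x - M.expect s a x) / (M.expect s a y - M.expect s b y))] with v hv _
          rw [div_le_iff₀ hpos] at hv
          linarith
        · refine Filter.Eventually.of_forall fun v _ => ?_
          have := hx b ⟨hb, fun c hc => by rw [h]; exact hy c hc⟩
          rw [h]; linarith
      · exact Filter.Eventually.of_forall fun v h => absurd h hb
    filter_upwards [Filter.eventually_all.2 this] with v hv
    exact ⟨ha, hv⟩
  · intro h
    obtain ⟨v₀, hv₀⟩ := Filter.eventually_atTop.1 h
    have ha := (hv₀ v₀ le_rfl).1
    have hy : ∀ b ∈ M.Act s, M.expect s b y ≤ M.expect s a y := by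
      intro b hb
      by_contra! hlt
      have hpos : 0 < M.expect s b y - M.expect s a y := by linarith
      obtain ⟨v, hv, hv'⟩ : ∃ v : ℝ, v₀ ≤ v ∧
          (M.expect s a x - M.expect s b x) / (M.expect s b y - M.expect s a y) < v :=
        ⟨max v₀ ((M.expect s a x - M.expect s b x) / (M.expect s b y - M.expect s a y) + 1),
          le_max_left _ _, lt_of_lt_of_le (by linarith) (le_max_right _ _)⟩
      rw [div_lt_iff₀ hpos] at hv'
      have := (hv₀ v hv).2 b hb
      linarith
    refine ⟨⟨ha, hy⟩, fun b ⟨hb, hb'⟩ => ?_⟩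
    have := (hv₀ v₀ le_rfl).2 b hb
    have h1 := le_antisymm (hy b hb) (hb' a ha)
    rw [h1] at this
    linarith

open Classical in
/-- `decisionValue(x, y, s, α)`; the supremum over the empty set is `-∞`. -/
noncomputable def decisionValue (x y : S → ℝ) (s : S) (a : A) : EReal :=
  (Finset.univ.filter fun b : A =>
      b ∈ M.Act s ∧ b ≠ a ∧ 0 < ∑ s', (M.P s a s' - M.P s b s') * y s').sup fun b =>
    (((∑ s', (M.P s b s' - M.P s a s') * x s') /
      (∑ s', (M.P s a s' - M.P s b s') * y s') : ℝ) : EReal)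

open Classical in
/-- The set `S_? = S \ (S₀ ∪ G)`. -/
noncomputable def unknownStates : Finset S :=
  Finset.univ.filter fun s => s ∉ M.zeroStates G ∪ G

open Classical in
/-- The values of the variables before the first iteration. -/
noncomputable def initVars : Vars S where
  x s := if s ∈ G then 1 else 0
  y s := if s ∈ M.unknownStates G then 1 else 0
  l := ⊥
  u := ⊤
  d := ⊥

open Classical in
/-- The vector `x_k` if `α s` is the action found for `s ∈ S_?`. -/
noncomputable def updateX (x : S → ℝ) (α : S → A) (s : S) : ℝ :=
  if s ∈ G then 1 else if s ∈ M.unknownStates G then M.expect s (α s) x else 0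

open Classical in
/-- The vector `y_k` if `α s` is the action found for `s ∈ S_?`. -/
noncomputable def updateY (y : S → ℝ) (α : S → A) (s : S) : ℝ :=
  if s ∈ M.unknownStates G then M.expect s (α s) y else 0

/-- The decision value `d_k` if `α s` is the action found for `s ∈ S_?`. -/
noncomputable def updateD (c : Vars S) (α : S → A) : EReal :=
  max c.d ((M.unknownStates G).sup fun s => M.decisionValue c.x c.y s (α s))

open Classical in
/-- The effect of one iteration of the loop on the variables if `α s` is the action found for
`s ∈ S_?`. The bounds `ℓ` and `u` keep their values if the condition of the if-statement fails. -/
noncomputable def iterate (c : Vars S) (α : S → A) : Vars S :=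
  let x' := M.updateX G c.x α
  let y' := M.updateY G c.y α
  let d' := M.updateD G c α
  let ratio : S → EReal := fun s => ((x' s / (1 - y' s) : ℝ) : EReal)
  if ∀ s ∈ M.unknownStates G, y' s < 1 then
    { x := x', y := y', d := d'
      l := max c.l ((M.unknownStates G).inf ratio)
      u := min c.u (max d' ((M.unknownStates G).sup ratio)) }
  else { x := x', y := y', d := d', l := c.l, u := c.u }

/-- `c'` may result from `c` by one iteration of the loop. -/
def Body (c c' : Vars S) : Prop :=
  ∃ α : S → A, (∀ s ∈ M.unknownStates G, α s ∈ M.findAction c.x c.y s c.u) ∧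
    c' = M.iterate G c α

/-- The exit condition `y_k[s_I] · (u_k - ℓ_k) < 2 · ε` of the loop. -/
def ExitCond (ε : ℝ) (c : Vars S) : Prop :=
  (c.y M.init : EReal) * (c.u - c.l) < ((2 * ε : ℝ) : EReal)

/-- The value `x_k[s_I] + y_k[s_I] · (ℓ_k + u_k) / 2`. -/
noncomputable def output (c : Vars S) : EReal :=
  (c.x M.init : EReal) + (c.y M.init : EReal) * ((c.l + c.u) / 2)

/-- One pass through the repeat-until loop, with the test at its end; the value is returned when
the loop is left. -/
inductive Step (ε : ℝ) : Config S → Config S → Prop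
  | loop (c c' : Vars S) : M.Body G c c' → ¬ M.ExitCond ε c' →
      Step ε (Config.running c) (Config.running c')
  | exit (c c' : Vars S) : M.Body G c c' → M.ExitCond ε c' →
      Step ε (Config.running c) (Config.returned (M.output c'))

end Algorithm

end MDP

/-! Let `V` be the vector of maximal reachability probabilities, and let `H k v` (`horizonValue`) be
the optimal `k`-step value if ending in `S_?` pays `v`. Bellman's equation for `V`
(`bellman_maxReachProb`) and monotonicity give `V ≤ H k v` if `V ≤ v` on `S_?`, and `H k v ≤ V` if
`v ≤ V` there.

The affine function `x_k + y_k v` is the `k`-step value of the actions actually chosen, so it is at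
most `H k v` for every `v`. For `d_k ≤ v ≤ u_k` it equals `H k v`: optimality at `u` persists for
smaller `v` until an action with smaller `y`-slope overtakes, and `d_k` records the largest such
crossing point (`expect_le_of_mem_findAction`).

Put `v = max V` over `S_?`, attained at `t`. If `v ≥ d_k`, then `v ≤ x_k[t] + y_k[t] v`, so `v` is
at most the ratio at `t`; this justifies `u_k`. The least ratio `m` satisfies `m ≤ H k m` on `S_?`,
and iterating this inequality gives `m ≤ V`, because contraction makes the optimal probability of
staying in `S_?` vanish (`tendsto_maxStayProb`); this justifies `ℓ_k`.

That probability also bounds `y_k`. Hence the bounds become finite and, being monotone, keep `u_k -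
ℓ_k` bounded while `y_k` tends to zero, which forces termination. At the exit `V[s_I]` lies between
`x + y ℓ` and `x + y u`, and the midpoint is returned. -/

namespace MDP

/-! ### Path measures: Markov property, superharmonic and subharmonic functions -/

section Paths

variable {S A : Type*} [Fintype S] {M : MDP S A}

theorem ae_of_lintegral_indicator {α : Type*} [MeasurableSpace α] {μ : Measure α} {p : α → Prop}
    (hp : MeasurableSet {a | p a}) (h : ∫⁻ a, {a | ¬ p a}.indicator 1 a ∂μ = 0) :
    ∀ᵐ a ∂μ, p a := by
  have h1 : MeasurableSet {a | ¬ p a} := hp.compl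
  rw [lintegral_indicator_one h1] at h
  exact h

theorem measurableSet_coord (p : M.Move → Prop) (n : ℕ) :
    MeasurableSet {w : ℕ → M.Move | p (w n)} := by
  have h : Measurable fun w : ℕ → M.Move => w n := measurable_pi_apply n
  exact h (MeasurableSet.of_discrete (s := {m : M.Move | p m}))

theorem ofReal_expect (M : MDP S A) (s : S) (a : A) {g : S → ℝ}
    (hg : ∀ s, 0 ≤ g s) :
    ∑ s', ENNReal.ofReal (M.P s a s') * ENNReal.ofReal (g s') =
      ENNReal.ofReal (∑ s', M.P s a s' * g s') := by
  rw [ENNReal.ofReal_sum_of_nonneg fun s' _ => mul_nonneg (M.P_nonneg _ _ _) (hg _)]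
  exact Finset.sum_congr rfl fun s' _ => (ENNReal.ofReal_mul (M.P_nonneg _ _ _)).symm

variable [Finite A]

instance (σ : M.Scheduler) (s : S) : IsProbabilityMeasure (σ.pathMeasure s) := by
  unfold Scheduler.pathMeasure
  infer_instance

theorem lintegral_next (σ : M.Scheduler) (h : List M.Move) (p : M.Move)
    (F : M.Move → ENNReal) :
    ∫⁻ m, F m ∂σ.next h p =
      ∑ s', ENNReal.ofReal (M.P p.state p.action s') * F (σ.move h s') := by
  simp only [Scheduler.next]
  rw [lintegral_finsetSum_measure]
  refine Finset.sum_congr rfl fun s' _ => ?_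
  rw [lintegral_smul_measure, lintegral_dirac, smul_eq_mul]

/-- The Markov property: the law of the next entry of a path, given the past. -/
theorem lintegral_pathMeasure_succ (σ : M.Scheduler) (s : S) (n : ℕ)
    (F : (Finset.Iic n → M.Move) → M.Move → ENNReal) :
    ∫⁻ w, F (Preorder.frestrictLe n w) (w (n + 1)) ∂σ.pathMeasure s =
      ∫⁻ w, ∑ s', ENNReal.ofReal (M.P (w n).state (w n).action s') *
        F (Preorder.frestrictLe n w)
          (σ.move (pastList n (Preorder.frestrictLe n w)) s') ∂σ.pathMeasure s := by
  have hF : Measurable fun p : (Finset.Iic n → M.Move) × M.Move => F p.1 p.2 :=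
    measurable_of_countable _
  set μ := σ.pathMeasure s with hμ
  -- The joint law of the past and the whole path is a composition product of the law of the past
  -- with the trajectory kernel. Of the latter only the marginal at time `n + 1` matters.
  have h1 : ∫⁻ w, F (Preorder.frestrictLe n w) (w (n + 1)) ∂μ =
      ∫⁻ q : (Finset.Iic n → M.Move) × (ℕ → M.Move), F q.1 (q.2 (n + 1))
        ∂(μ.map fun x => (Preorder.frestrictLe (π := fun _ => M.Move) n x, x)) := by
    rw [lintegral_map]
    · exact hF.comp (measurable_fst.prodMk ((measurable_pi_apply (n + 1)).comp measurable_snd))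
    · exact (Preorder.measurable_frestrictLe n).prodMk measurable_id
  rw [h1, hμ, Scheduler.pathMeasure, ← Kernel.partialTraj_compProd_traj (zero_le (a := n)),
    Measure.lintegral_compProd, ← Kernel.traj_map_frestrictLe_apply, lintegral_map]
  · refine lintegral_congr fun w => ?_
    have h2 : ∀ G : M.Move → ENNReal, ∫⁻ x : ℕ → M.Move, G (x (n + 1))
        ∂Kernel.traj (X := fun _ => M.Move) σ.kernel n (Preorder.frestrictLe n w) =
        ∫⁻ m, G m ∂σ.kernel n (Preorder.frestrictLe n w) := by
      intro G
      conv_rhs => rw [← Kernel.map_traj_succ_self (X := fun _ => M.Move) (κ := σ.kernel)]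
      rw [Kernel.map_apply _ (measurable_pi_apply (n + 1)), lintegral_map]
      · exact measurable_of_countable _
      · exact measurable_pi_apply (n + 1)
    refine (h2 (F (Preorder.frestrictLe n w))).trans ?_
    exact lintegral_next σ _ _ _
  · exact measurable_of_countable _
  · exact Preorder.measurable_frestrictLe n
  · exact hF.comp (measurable_fst.prodMk ((measurable_pi_apply (n + 1)).comp measurable_snd))

theorem lintegral_pathMeasure_zero (σ : M.Scheduler) (s : S) (F : M.Move → ENNReal) :
    ∫⁻ w, F (w 0) ∂σ.pathMeasure s = F (σ.move [] s) := by
  have h1 : ∫⁻ w, F (w 0) ∂σ.pathMeasure s =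
      ∫⁻ q : Finset.Iic 0 → M.Move, F (q ⟨0, Finset.mem_Iic.2 le_rfl⟩)
        ∂((σ.pathMeasure s).map (Preorder.frestrictLe (π := fun _ => M.Move) 0)) := by
    rw [lintegral_map]
    · rfl
    · exact measurable_of_countable _
    · exact Preorder.measurable_frestrictLe 0
  rw [h1, Scheduler.pathMeasure, Kernel.traj_map_frestrictLe_apply, Kernel.partialTraj_self,
    Kernel.id_apply, lintegral_dirac]

theorem lintegral_state_succ (σ : M.Scheduler) (s : S) (n : ℕ) (g : S → ENNReal) :
    ∫⁻ w, g (w (n + 1)).state ∂σ.pathMeasure s =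
      ∫⁻ w, ∑ s', ENNReal.ofReal (M.P (w n).state (w n).action s') * g s'
        ∂σ.pathMeasure s :=
  lintegral_pathMeasure_succ σ s n fun _ m => g m.state

/-- A set of states that no enabled action leaves is almost surely never left. -/
theorem ae_state_succ_mem {T : Set S}
    (hT : ∀ s ∈ T, ∀ a ∈ M.Act s, ∀ s', s' ∉ T → M.P s a s' = 0)
    (σ : M.Scheduler) (s : S) :
    ∀ᵐ w ∂σ.pathMeasure s, ∀ n, (w n).state ∈ T → (w (n + 1)).state ∈ T := by
  classical
  refine ae_all_iff.2 fun n => ae_of_lintegral_indicator ?_ ?_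
  · exact (measurableSet_coord (fun m => m.state ∈ T) n).imp
      (measurableSet_coord (fun m => m.state ∈ T) (n + 1))
  · have := lintegral_pathMeasure_succ σ s n fun q m =>
      if (q ⟨n, Finset.mem_Iic.2 le_rfl⟩).state ∈ T ∧ m.state ∉ T then 1 else 0
    simp only [Set.indicator, Set.mem_ofPred_eq, Classical.not_imp, Pi.one_apply]
    refine this.trans ?_
    refine (lintegral_congr fun w => Finset.sum_eq_zero fun s' _ => ?_).trans lintegral_zero
    change _ * (if (w n).state ∈ T ∧ s' ∉ T then (1 : ENNReal) else 0) = 0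
    split_ifs with h
    · have h0 : M.P (w n).state (w n).action s' = 0 := hT _ h.1 _ (w n).2 _ h.2
      simp [h0]
    · simp

/-- The probability to be in a closed set at time `n` tends to the reachability probability. -/
theorem tendsto_measure_state_mem {T : Set S}
    (hT : ∀ s ∈ T, ∀ a ∈ M.Act s, ∀ s', s' ∉ T → M.P s a s' = 0)
    (σ : M.Scheduler) (s : S) :
    Filter.Tendsto (fun n => σ.pathMeasure s {w | (w n).state ∈ T}) Filter.atTop
      (nhds (σ.pathMeasure s (M.reach T))) := by
  -- Closedness turns being in `T` at time `n` into having visited `T` by time `n`, up to null sets;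
  -- the latter events increase to `reach`.
  have h1 : ∀ n, σ.pathMeasure s {w | (w n).state ∈ T} =
      σ.pathMeasure s {w | ∃ j ≤ n, (w j).state ∈ T} := by
    intro n
    refine measure_congr ?_
    filter_upwards [ae_state_succ_mem hT σ s] with w hw
    refine propext ⟨fun h => ⟨n, le_rfl, h⟩, ?_⟩
    rintro ⟨j, hj, hjT⟩
    induction n, hj using Nat.le_induction with
    | base => exact hjT
    | succ k _ ih => exact hw k ih
  have h2 : M.reach T = ⋃ n, {w | ∃ j ≤ n, (w j).state ∈ T} := by
    ext w
    simp only [reach, Set.mem_iUnion, Set.mem_ofPred_eq]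
    exact ⟨fun ⟨j, hj⟩ => ⟨j, j, le_rfl, hj⟩, fun ⟨_, j, _, hj⟩ => ⟨j, hj⟩⟩
  simp only [h1, h2]
  exact tendsto_measure_iUnion_atTop fun m n hmn w ⟨j, hj, h⟩ => ⟨j, hj.trans hmn, h⟩

theorem measure_state_mem_le_reach (T : Set S) (σ : M.Scheduler) (s : S) (n : ℕ) :
    σ.pathMeasure s {w | (w n).state ∈ T} ≤ σ.pathMeasure s (M.reach T) :=
  measure_mono fun _ hw => ⟨n, hw⟩

/-- The expected value of a superharmonic function decreases along the paths. -/
theorem lintegral_superharmonic_le {g : S → ℝ} (hg : ∀ s, 0 ≤ g s)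
    (hsup : ∀ s, ∀ a ∈ M.Act s, ∑ s', M.P s a s' * g s' ≤ g s) (σ : M.Scheduler) (s : S)
    (n : ℕ) :
    ∫⁻ w, ENNReal.ofReal (g (w n).state) ∂σ.pathMeasure s ≤ ENNReal.ofReal (g s) := by
  induction n with
  | zero =>
    exact (lintegral_pathMeasure_zero σ s fun m => ENNReal.ofReal (g m.state)).le
  | succ n ih =>
    rw [lintegral_state_succ σ s n fun s => ENNReal.ofReal (g s)]
    refine le_trans (lintegral_mono fun w => ?_) ih
    rw [ofReal_expect M _ _ hg]
    exact ENNReal.ofReal_le_ofReal (hsup _ _ (w n).2)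

/-- The scheduler that selects the action `a n s` in the state `s` at time `n`. -/
def markovScheduler (a : ℕ → S → A) (ha : ∀ n s, a n s ∈ M.Act s) : M.Scheduler where
  act h s := a h.length s
  enabled _ s := ha _ s

theorem ae_action_eq (a : ℕ → S → A) (ha : ∀ n s, a n s ∈ M.Act s) (s : S) (n : ℕ) :
    ∀ᵐ w ∂(markovScheduler a ha).pathMeasure s, (w n).action = a n (w n).state := by
  classical
  refine ae_of_lintegral_indicator
    (measurableSet_coord (fun m => m.action = a n m.state) n) ?_
  simp only [Set.indicator, Set.mem_ofPred_eq, Pi.one_apply]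
  cases n with
  | zero =>
    refine (lintegral_pathMeasure_zero _ s
      fun m => if ¬ m.action = a 0 m.state then 1 else 0).trans (if_neg (not_not.2 rfl))
  | succ n =>
    refine (lintegral_pathMeasure_succ _ s n
      fun _ m => if ¬ m.action = a (n + 1) m.state then 1 else 0).trans ?_
    refine (lintegral_congr fun w => Finset.sum_eq_zero fun s' _ => ?_).trans lintegral_zero
    rw [if_neg, mul_zero]
    refine not_not.2 ?_
    -- The past preceding the entry at time `n + 1` has `n + 1` elements, so list length is time.
    change a (pastList n _).length s' = a (n + 1) s'
    rw [pastList, List.length_ofFn]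

/-- If `g` is subharmonic for a sequence of decision rules, the expected value of `g` increases
along the paths. -/
theorem le_lintegral_subharmonic {g : ℕ → S → ℝ} (hg : ∀ n s, 0 ≤ g n s)
    (a : ℕ → S → A) (ha : ∀ n s, a n s ∈ M.Act s)
    (hsub : ∀ n s, g n s ≤ ∑ s', M.P s (a n s) s' * g (n + 1) s') (s : S) (n : ℕ) :
    ENNReal.ofReal (g 0 s) ≤
      ∫⁻ w, ENNReal.ofReal (g n (w n).state) ∂(markovScheduler a ha).pathMeasure s := by
  induction n with
  | zero =>
    exact (lintegral_pathMeasure_zero _ s fun m => ENNReal.ofReal (g 0 m.state)).ge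
  | succ n ih =>
    rw [lintegral_state_succ _ s n fun s => ENNReal.ofReal (g (n + 1) s)]
    refine ih.trans (lintegral_mono_ae ?_)
    filter_upwards [ae_action_eq a ha s n] with w hw
    rw [ofReal_expect M _ _ (hg _), hw]
    exact ENNReal.ofReal_le_ofReal (hsub _ _)

end Paths

end MDP

namespace MDP

/-! ### Bellman operators -/

section Bellman

open Filter Topology

variable {S A : Type*} [Fintype S] (M : MDP S A)

theorem expect_mono {s : S} {a : A} {f g : S → ℝ} (h : f ≤ g) :
    M.expect s a f ≤ M.expect s a g :=
  Finset.sum_le_sum fun s' _ => mul_le_mul_of_nonneg_left (h s') (M.P_nonneg _ _ _)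

theorem expect_nonneg {s : S} {a : A} {f : S → ℝ} (h : 0 ≤ f) : 0 ≤ M.expect s a f :=
  Finset.sum_nonneg fun s' _ => mul_nonneg (M.P_nonneg _ _ _) (h s')

theorem expect_add_mul (s : S) (a : A) (f g : S → ℝ) (c : ℝ) :
    M.expect s a (fun s' => f s' + g s' * c) = M.expect s a f + M.expect s a g * c := by
  simp only [expect, mul_add, Finset.sum_add_distrib, Finset.sum_mul, mul_assoc]

theorem expect_const {s : S} {a : A} (ha : a ∈ M.Act s) (c : ℝ) :
    M.expect s a (fun _ => c) = c := by
  have h : ∑ s', M.P s a s' = 1 := ha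
  rw [expect, ← Finset.sum_mul, h, one_mul]

theorem le_expect_of_self_loop {s : S} {a : A} (h : M.P s a s = 1) {f : S → ℝ} (hf : 0 ≤ f) :
    f s ≤ M.expect s a f := by
  have := Finset.single_le_sum (f := fun s' => M.P s a s' * f s')
    (fun s' _ => mul_nonneg (M.P_nonneg _ _ _) (hf s')) (Finset.mem_univ s)
  simpa [h, expect] using this

theorem P_eq_zero_of_self_loop {s : S} {a : A} (ha : a ∈ M.Act s) (h : M.P s a s = 1) {s' : S}
    (hs : s' ≠ s) : M.P s a s' = 0 := by
  classical
  have h1 : ∑ s', M.P s a s' = 1 := ha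
  rw [← Finset.add_sum_erase _ _ (Finset.mem_univ s), h] at h1
  have h2 : ∑ x ∈ Finset.univ.erase s, M.P s a x = 0 := by linarith
  exact (Finset.sum_eq_zero_iff_of_nonneg fun x _ => M.P_nonneg _ _ _).1 h2 s'
    (Finset.mem_erase.2 ⟨hs, Finset.mem_univ _⟩)

variable [Fintype A]

open Classical in
/-- The finite set of the actions that are enabled in `s`. -/
noncomputable def actFinset (s : S) : Finset A := Finset.univ.filter (· ∈ M.Act s)

theorem mem_actFinset {s : S} {a : A} : a ∈ M.actFinset s ↔ a ∈ M.Act s := by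
  simp [actFinset]

theorem actFinset_nonempty (s : S) : (M.actFinset s).Nonempty :=
  (M.exists_enabled s).imp fun _ ha => M.mem_actFinset.2 ha

open Classical in
/-- The Bellman operator for maximal expectations on `U`, with boundary values `b`. -/
noncomputable def bellman (U : Set S) (b f : S → ℝ) (s : S) : ℝ :=
  if s ∈ U then (M.actFinset s).sup' (M.actFinset_nonempty s) (fun a => M.expect s a f) else b s

variable {M} {U : Set S} {b f g h : S → ℝ} {s : S}

theorem bellman_of_notMem (hs : s ∉ U) : M.bellman U b f s = b s := if_neg hs

theorem expect_le_bellman (hs : s ∈ U) {a : A} (ha : a ∈ M.Act s) :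
    M.expect s a f ≤ M.bellman U b f s := by
  rw [bellman, if_pos hs]
  exact Finset.le_sup' (fun a => M.expect s a f) (M.mem_actFinset.2 ha)

theorem exists_bellman_eq (b f : S → ℝ) (hs : s ∈ U) :
    ∃ a ∈ M.Act s, M.bellman U b f s = M.expect s a f := by
  rw [bellman, if_pos hs]
  obtain ⟨a, ha, h⟩ := Finset.exists_mem_eq_sup' (M.actFinset_nonempty s)
    (fun a => M.expect s a f)
  exact ⟨a, M.mem_actFinset.1 ha, h⟩

theorem bellman_mono : Monotone (M.bellman U b) := by
  intro f g hfg s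
  by_cases hs : s ∈ U
  · obtain ⟨a, ha, h⟩ := exists_bellman_eq (M := M) b f hs
    rw [h]
    exact (M.expect_mono hfg).trans (expect_le_bellman hs ha)
  · rw [bellman_of_notMem hs, bellman_of_notMem hs]

theorem bellman_add_mul_le {δ : ℝ} (hδ : 0 ≤ δ) :
    M.bellman U b (fun s => f s + h s * δ) s ≤ M.bellman U b f s + M.bellman U 0 h s * δ := by
  by_cases hs : s ∈ U
  · obtain ⟨a, ha, h1⟩ := exists_bellman_eq (M := M) b (fun s => f s + h s * δ) hs
    rw [h1, expect_add_mul]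
    exact add_le_add (expect_le_bellman hs ha)
      (mul_le_mul_of_nonneg_right (expect_le_bellman hs ha) hδ)
  · simp [bellman_of_notMem hs]

/-- An optimal action for the sum is merely a candidate for each summand. A perturbation of the
terminal values is thus propagated by the operator with boundary values `0`; for the indicator of
`S_?` this yields stay probabilities. -/
theorem iterate_bellman_add_mul_le {δ : ℝ} (hδ : 0 ≤ δ) (n : ℕ) :
    (M.bellman U b)^[n] (fun s => f s + h s * δ) ≤
      fun s => (M.bellman U b)^[n] f s + (M.bellman U 0)^[n] h s * δ := by
  induction n with
  | zero => exact le_rfl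
  | succ n ih =>
    simp only [Function.iterate_succ_apply']
    exact (bellman_mono ih).trans fun s => bellman_add_mul_le hδ

theorem iterate_bellman_le (hfg : f ≤ g) (hg : M.bellman U b g ≤ g) (n : ℕ) :
    (M.bellman U b)^[n] f ≤ g := by
  induction n with
  | zero => exact hfg
  | succ n ih =>
    rw [Function.iterate_succ_apply']
    exact (bellman_mono ih).trans hg

theorem le_iterate_bellman (hgf : g ≤ f) (hg : g ≤ M.bellman U b g) (n : ℕ) :
    g ≤ (M.bellman U b)^[n] f := by
  induction n with
  | zero => exact hgf
  | succ n ih =>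
    rw [Function.iterate_succ_apply']
    exact hg.trans (bellman_mono ih)

theorem tendsto_bellman {ι : Type*} {l : Filter ι} {F : ι → S → ℝ}
    (hF : ∀ s, Tendsto (fun i => F i s) l (𝓝 (f s))) (s : S) :
    Tendsto (fun i => M.bellman U b (F i) s) l (𝓝 (M.bellman U b f s)) := by
  by_cases hs : s ∈ U
  · simp only [bellman, if_pos hs]
    exact Tendsto.finset_sup'_nhds_apply _ fun a _ =>
      tendsto_finsetSum _ fun s' _ => (hF s').const_mul _
  · simp only [bellman_of_notMem hs]
    exact tendsto_const_nhds

theorem bellman_eq_of_tendsto_iterate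
    (hf : ∀ s, Tendsto (fun n => (M.bellman U b)^[n] g s) atTop (𝓝 (f s))) :
    M.bellman U b f = f := by
  funext s
  refine tendsto_nhds_unique (tendsto_bellman hf s) ?_
  have h := (tendsto_add_atTop_iff_nat 1).2 (hf s)
  simpa only [Function.iterate_succ_apply'] using h

end Bellman

/-! ### Bellman's equation for reachability, and stay probabilities -/

section MaxReach

open Filter Topology

variable {S A : Type*} [Fintype S] {M : MDP S A} {G : Set S}

theorem IsAbsorbing.P_eq_zero (hG : ∀ s ∈ G, M.IsAbsorbing s) :
    ∀ s ∈ G, ∀ a ∈ M.Act s, ∀ s', s' ∉ G → M.P s a s' = 0 := fun s hs a ha _ hs' =>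
  M.P_eq_zero_of_self_loop ha (hG s hs a ha) fun h => hs' (h ▸ hs)

instance : Nonempty M.Scheduler :=
  ⟨⟨fun _ s => (M.exists_enabled s).choose, fun _ s => (M.exists_enabled s).choose_spec⟩⟩

section

variable [Finite A]

theorem reachProb_le_one (σ : M.Scheduler) (s : S) : M.reachProb σ s G ≤ 1 :=
  measureReal_le_one

theorem reachProb_le_maxReachProb (σ : M.Scheduler) (s : S) :
    M.reachProb σ s G ≤ M.maxReachProb s G :=
  le_ciSup (f := fun σ => M.reachProb σ s G) ⟨1, fun _ ⟨σ, h⟩ => h ▸ reachProb_le_one σ s⟩ σ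

theorem maxReachProb_nonneg (s : S) : 0 ≤ M.maxReachProb s G :=
  Real.iSup_nonneg fun _ => measureReal_nonneg

theorem maxReachProb_le_one (s : S) : M.maxReachProb s G ≤ 1 :=
  ciSup_le fun σ => reachProb_le_one σ s

/-- A superharmonic majorant of the indicator function of an absorbing set bounds the
reachability probability. -/
theorem reachProb_le_of_superharmonic (hG : ∀ s ∈ G, M.IsAbsorbing s) {g : S → ℝ}
    (hg : ∀ s, 0 ≤ g s) (hg1 : ∀ s ∈ G, 1 ≤ g s)
    (hsup : ∀ s, ∀ a ∈ M.Act s, M.expect s a g ≤ g s) (σ : M.Scheduler) (s : S) :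
    M.reachProb σ s G ≤ g s := by
  refine ENNReal.toReal_le_of_le_ofReal (hg s) ?_
  refine le_of_tendsto' (tendsto_measure_state_mem (IsAbsorbing.P_eq_zero hG) σ s) fun n => ?_
  refine le_trans ?_ (lintegral_superharmonic_le hg hsup σ s n)
  rw [← lintegral_indicator_one (measurableSet_coord (fun m => m.state ∈ G) n)]
  refine lintegral_mono fun w => ?_
  by_cases hw : (w n).state ∈ G
  · refine (Set.indicator_le_self' (fun _ _ => zero_le) w).trans ?_
    exact ENNReal.one_le_ofReal.2 (hg1 _ hw)
  · rw [Set.indicator_of_notMem (by exact hw)]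
    exact zero_le

/-- The witnessing actions form a scheduler under which `g 0 s` is at most the probability of being
in `G` at time `n`. The rules depend on time because finite-horizon optimal actions depend on the
number of remaining steps. -/
theorem le_maxReachProb_of_subharmonic {g : ℕ → S → ℝ} (hg : ∀ n s, 0 ≤ g n s)
    (hsub : ∀ n s, ∃ a ∈ M.Act s, g n s ≤ M.expect s a (g (n + 1)))
    {n : ℕ} (hn : g n ≤ G.indicator 1) (s : S) : g 0 s ≤ M.maxReachProb s G := by
  choose a ha hga using hsub
  refine le_trans ?_ (reachProb_le_maxReachProb (markovScheduler a ha) s)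
  refine (ENNReal.ofReal_le_iff_le_toReal (measure_ne_top _ _)).1 ?_
  refine (le_lintegral_subharmonic hg a ha hga s n).trans ?_
  refine le_trans ?_ (measure_state_mem_le_reach G _ s n)
  rw [← lintegral_indicator_one (measurableSet_coord (fun m => m.state ∈ G) n)]
  refine lintegral_mono fun w => ?_
  by_cases hw : (w n).state ∈ G
  · rw [Set.indicator_of_mem (by exact hw)]
    refine ENNReal.ofReal_le_one.2 ((hn _).trans ?_)
    rw [Set.indicator_of_mem hw, Pi.one_apply]
  · have := hn (w n).state
    rw [Set.indicator_of_notMem hw] at this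
    rw [ENNReal.ofReal_of_nonpos this]
    exact zero_le

end

variable [Fintype A]

/-- Bellman's equation for the maximal reachability probabilities. -/
theorem bellman_maxReachProb (hG : ∀ s ∈ G, M.IsAbsorbing s) :
    M.bellman Gᶜ (G.indicator 1) (fun s => M.maxReachProb s G) = fun s => M.maxReachProb s G := by
  set b : S → ℝ := G.indicator 1 with hb
  have hb0 : 0 ≤ b := fun s => Set.indicator_nonneg (fun _ _ => zero_le_one) s
  have hb1 : b ≤ fun _ => 1 := fun s => Set.indicator_le_self' (fun _ _ => zero_le_one) s
  have hstep : b ≤ M.bellman Gᶜ b b := by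
    intro s
    by_cases hs : s ∈ G
    · rw [bellman_of_notMem (by simpa using hs)]
    · obtain ⟨a, -, h⟩ := exists_bellman_eq (M := M) b b (U := Gᶜ) hs
      rw [h, hb, Set.indicator_of_notMem hs]
      exact M.expect_nonneg hb0
  have hone : M.bellman Gᶜ b (fun _ => 1) ≤ fun _ => 1 := by
    intro s
    by_cases hs : s ∈ G
    · rw [bellman_of_notMem (by simpa using hs)]; exact hb1 s
    · obtain ⟨a, ha, h⟩ := exists_bellman_eq (M := M) b (fun _ => 1) (U := Gᶜ) hs
      rw [h, M.expect_const ha]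
  have hmono : Monotone fun n => (M.bellman Gᶜ b)^[n] b :=
    bellman_mono.monotone_iterate_of_le_map hstep
  have hle1 := iterate_bellman_le hb1 hone
  have hbG : ∀ n, ∀ s ∈ G, (M.bellman Gᶜ b)^[n] b s = 1 := by
    intro n s hs
    refine le_antisymm (hle1 n s) ?_
    have := hmono (zero_le (a := n)) s
    simpa [hb, Set.indicator_of_mem hs] using this
  have hnonneg : ∀ n, 0 ≤ (M.bellman Gᶜ b)^[n] b := fun n => hb0.trans (hmono (zero_le (a := n)))
  obtain ⟨W, hW⟩ : ∃ W : S → ℝ, ∀ s,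
      Tendsto (fun n => (M.bellman Gᶜ b)^[n] b s) atTop (𝓝 (W s)) :=
    ⟨_, fun s => tendsto_atTop_ciSup (fun m n hmn => hmono hmn s)
      ⟨1, fun _ ⟨n, h⟩ => h ▸ hle1 n s⟩⟩
  have hfix := bellman_eq_of_tendsto_iterate hW
  have hW1 : W ≤ fun _ => 1 := fun s => le_of_tendsto' (hW s) fun n => hle1 n s
  have hWG : ∀ s ∈ G, 1 ≤ W s := fun s hs =>
    ge_of_tendsto' (hW s) fun n => (hbG n s hs).ge
  -- The limit `W` of value iteration is superharmonic, hence bounds every scheduler; each iterate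
  -- is in turn bounded by what a finite-horizon scheduler achieves.
  suffices h : (fun s => M.maxReachProb s G) = W by rw [h, hfix]
  funext s
  refine le_antisymm (ciSup_le fun σ => ?_) (le_of_tendsto' (hW s) fun n => ?_)
  · refine reachProb_le_of_superharmonic hG
      (fun s => ge_of_tendsto' (hW s) fun n => hnonneg n s) hWG (fun s a ha => ?_) σ s
    by_cases hs : s ∈ G
    · exact ((M.expect_mono hW1).trans (M.expect_const ha 1).le).trans (hWG s hs)
    · refine (expect_le_bellman (U := Gᶜ) (b := b) hs ha).trans (congrFun hfix s).le
  -- At time `k` there are `n - k` steps left. After the horizon truncated subtraction leaves `b`,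
  -- which is subharmonic for any enabled action.
  · refine le_maxReachProb_of_subharmonic (g := fun k => (M.bellman Gᶜ b)^[n - k] b) (n := n)
      (fun k => hnonneg _) (fun k s => ?_) (by simp [hb]) s
    by_cases hs : s ∈ G
    · obtain ⟨a, ha⟩ := M.exists_enabled s
      refine ⟨a, ha, ?_⟩
      rw [hbG _ s hs]
      refine (hbG (n - (k + 1)) s hs).ge.trans ?_
      exact M.le_expect_of_self_loop (hG s hs a ha) (hnonneg _)
    · rcases lt_or_ge k n with hk | hk
      · obtain ⟨a, ha, h⟩ := exists_bellman_eq (M := M) b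
          ((M.bellman Gᶜ b)^[n - (k + 1)] b) (U := Gᶜ) hs
        refine ⟨a, ha, ?_⟩
        rw [← h, ← Function.iterate_succ_apply' (M.bellman Gᶜ b),
          show (n - (k + 1)).succ = n - k by omega]
      · obtain ⟨a, ha⟩ := M.exists_enabled s
        refine ⟨a, ha, ?_⟩
        rw [Nat.sub_eq_zero_of_le hk, Nat.sub_eq_zero_of_le (hk.trans k.le_succ)]
        simp only [Function.iterate_zero, id_eq]
        rw [hb, Set.indicator_of_notMem hs]
        exact M.expect_nonneg hb0

theorem maxReachProb_of_mem (hG : ∀ s ∈ G, M.IsAbsorbing s) {s : S} (hs : s ∈ G) :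
    M.maxReachProb s G = 1 := by
  have := congrFun (bellman_maxReachProb hG) s
  rw [bellman_of_notMem (by simpa using hs), Set.indicator_of_mem hs] at this
  exact this.symm

theorem expect_maxReachProb_le (hG : ∀ s ∈ G, M.IsAbsorbing s) {s : S} {a : A}
    (ha : a ∈ M.Act s) :
    M.expect s a (fun s => M.maxReachProb s G) ≤ M.maxReachProb s G := by
  by_cases hs : s ∈ G
  · rw [maxReachProb_of_mem hG hs]
    exact (M.expect_mono fun s => maxReachProb_le_one s).trans (M.expect_const ha 1).le
  · exact (expect_le_bellman (U := Gᶜ) hs ha).trans (congrFun (bellman_maxReachProb hG) s).le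

theorem mem_unknownStates {s : S} :
    s ∈ M.unknownStates G ↔ M.maxReachProb s G ≠ 0 ∧ s ∉ G := by
  classical
  refine (Finset.mem_filter (p := fun s => s ∉ M.zeroStates G ∪ G)).trans ?_
  rw [Set.mem_union, not_or]
  exact and_iff_right (Finset.mem_univ s)

theorem maxReachProb_of_notMem_unknownStates (hG : ∀ s ∈ G, M.IsAbsorbing s) {s : S}
    (hs : s ∉ M.unknownStates G) : M.maxReachProb s G = G.indicator 1 s := by
  by_cases h : s ∈ G
  · rw [maxReachProb_of_mem hG h, Set.indicator_of_mem h, Pi.one_apply]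
  · rw [Set.indicator_of_notMem h]
    by_contra h0
    exact hs (mem_unknownStates.2 ⟨h0, h⟩)

/-- Bellman's equation, restricted to `S_?`. -/
theorem bellman_unknownStates_maxReachProb (hG : ∀ s ∈ G, M.IsAbsorbing s) :
    M.bellman (M.unknownStates G) (G.indicator 1) (fun s => M.maxReachProb s G) =
      fun s => M.maxReachProb s G := by
  funext s
  by_cases hs : s ∈ M.unknownStates G
  · have h := congrFun (bellman_maxReachProb hG) s
    have hs' : s ∈ Gᶜ := (mem_unknownStates.1 hs).2
    rw [bellman, if_pos hs'] at h
    rw [bellman, if_pos (Finset.mem_coe.2 hs), h]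
  · rw [bellman_of_notMem (by simpa using hs), maxReachProb_of_notMem_unknownStates hG hs]

/-- The set `G ∪ S₀` is never left. -/
theorem P_eq_zero_of_mem_union (hG : ∀ s ∈ G, M.IsAbsorbing s) :
    ∀ s ∈ G ∪ M.zeroStates G, ∀ a ∈ M.Act s, ∀ s', s' ∉ G ∪ M.zeroStates G →
      M.P s a s' = 0 := by
  rintro s (hs | hs) a ha s' hs'
  · exact IsAbsorbing.P_eq_zero hG s hs a ha s' fun h => hs' (Or.inl h)
  · have h0 : M.maxReachProb s G = 0 := hs
    have h1 := expect_maxReachProb_le hG ha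
    rw [h0] at h1
    have h2 : ∀ x ∈ Finset.univ, 0 ≤ M.P s a x * M.maxReachProb x G := fun x _ =>
      mul_nonneg (M.P_nonneg _ _ _) (maxReachProb_nonneg x)
    -- A vanishing average of nonnegative values forces value zero at each successor of positive
    -- probability.
    have h3 := (Finset.sum_eq_zero_iff_of_nonneg h2).1 (le_antisymm h1 (Finset.sum_nonneg h2))
      s' (Finset.mem_univ _)
    exact (mul_eq_zero.1 h3).resolve_right fun h => hs' (Or.inr h)

variable (M G) in
/-- The maximal probability to stay in `S_?` for `n` steps. -/
noncomputable def maxStayProb (n : ℕ) : S → ℝ :=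
  (M.bellman (M.unknownStates G) 0)^[n] ((M.unknownStates G : Set S).indicator 1)

theorem maxStayProb_nonneg (n : ℕ) : 0 ≤ M.maxStayProb G n := by
  refine le_iterate_bellman (g := 0) (fun s => Set.indicator_nonneg (fun _ _ => zero_le_one) s)
    (fun s => ?_) n
  by_cases hs : s ∈ (M.unknownStates G : Set S)
  · obtain ⟨a, -, h⟩ := exists_bellman_eq (M := M) 0 0 hs
    rw [h]
    exact M.expect_nonneg le_rfl
  · rw [bellman_of_notMem hs]

theorem bellman_indicator_unknownStates_le :
    M.bellman (M.unknownStates G) 0 ((M.unknownStates G : Set S).indicator 1) ≤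
      (M.unknownStates G : Set S).indicator 1 := by
  intro s
  by_cases hs : s ∈ (M.unknownStates G : Set S)
  · obtain ⟨a, ha, h⟩ := exists_bellman_eq (M := M) 0
      ((M.unknownStates G : Set S).indicator 1) hs
    rw [h, Set.indicator_of_mem hs]
    refine le_trans (M.expect_mono (g := fun _ => 1) fun s => ?_) (M.expect_const ha 1).le
    exact Set.indicator_le_self' (fun _ _ => zero_le_one) s
  · rw [bellman_of_notMem hs, Set.indicator_of_notMem hs, Pi.zero_apply]

/-- In a contracting MDP, the set `S_?` is left eventually, uniformly for all schedulers. -/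
theorem tendsto_maxStayProb (hG : ∀ s ∈ G, M.IsAbsorbing s)
    (hM : M.IsContracting (G ∪ M.zeroStates G)) (s : S) :
    Tendsto (fun n => M.maxStayProb G n s) atTop (𝓝 0) := by
  have hanti : Antitone (M.maxStayProb G) :=
    bellman_mono.antitone_iterate_of_map_le bellman_indicator_unknownStates_le
  obtain ⟨p, hp⟩ : ∃ p : S → ℝ, ∀ s, Tendsto (fun n => M.maxStayProb G n s) atTop (𝓝 (p s)) :=
    ⟨_, fun s => tendsto_atTop_ciInf (fun m n hmn => hanti hmn s)
      ⟨0, fun _ ⟨n, h⟩ => h ▸ maxStayProb_nonneg n s⟩⟩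
  have hfix := bellman_eq_of_tendsto_iterate hp
  have hp0 : 0 ≤ p := fun s => ge_of_tendsto' (hp s) fun n => maxStayProb_nonneg n s
  have hp1 : p ≤ (M.unknownStates G : Set S).indicator 1 := fun s =>
    le_of_tendsto' (hp s) fun n => hanti (zero_le (a := n)) s
  -- The limit `p` is a fixed point, so its greedy actions give one stationary scheduler for which
  -- `p` is subharmonic.
  have hact : ∀ s, ∃ a ∈ M.Act s, p s ≤ M.expect s a p := by
    intro s
    by_cases hs : s ∈ (M.unknownStates G : Set S)
    · obtain ⟨a, ha, h⟩ := exists_bellman_eq (M := M) 0 p hs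
      exact ⟨a, ha, (congrFun hfix s).ge.trans h.le⟩
    · obtain ⟨a, ha⟩ := M.exists_enabled s
      refine ⟨a, ha, ?_⟩
      rw [← hfix, bellman_of_notMem hs, hfix]
      exact M.expect_nonneg hp0
  choose a ha hpa using hact
  set σ := markovScheduler (fun _ => a) fun _ => ha
  have hT := tendsto_measure_state_mem (P_eq_zero_of_mem_union hG) σ s
  have h1 : σ.pathMeasure s (M.reach (G ∪ M.zeroStates G)) = 1 := by
    have := hM s σ
    rw [reachProb, Measure.real] at this
    rwa [ENNReal.toReal_eq_one_iff] at this
  rw [h1] at hT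
  -- As `p` is at most the indicator of `S_?`, `p s` is at most the probability of being outside the
  -- closed set `G ∪ S₀` at time `n`, which tends to zero by contraction.
  have hle : ∀ n, ENNReal.ofReal (p s) ≤
      1 - σ.pathMeasure s {w | (w n).state ∈ G ∪ M.zeroStates G} := by
    intro n
    have hmeas := measurableSet_coord (M := M) (fun m => m.state ∈ G ∪ M.zeroStates G) n
    rw [← prob_compl_eq_one_sub hmeas, ← lintegral_indicator_one hmeas.compl]
    refine (le_lintegral_subharmonic (g := fun _ => p) (fun _ => hp0) (fun _ => a)
      (fun _ => ha) (fun _ => hpa) s n).trans (lintegral_mono fun w => ?_)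
    by_cases hw : (w n).state ∈ (M.unknownStates G : Set S)
    · rw [Set.indicator_of_mem]
      · refine ENNReal.ofReal_le_one.2 ((hp1 _).trans ?_)
        rw [Set.indicator_of_mem hw, Pi.one_apply]
      · have := mem_unknownStates.1 (Finset.mem_coe.1 hw)
        rintro (h | h)
        · exact this.2 h
        · exact this.1 h
    · have := hp1 (w n).state
      rw [Set.indicator_of_notMem hw] at this
      rw [ENNReal.ofReal_of_nonpos this]
      exact zero_le
  have hlim : ENNReal.ofReal (p s) ≤ 1 - 1 :=
    ge_of_tendsto' (ENNReal.Tendsto.sub tendsto_const_nhds hT (Or.inl ENNReal.one_ne_top)) hle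
  have hps : p s ≤ 0 := by simpa using hlim
  exact le_antisymm hps (hp0 s) ▸ hp s

end MaxReach

end MDP

namespace MDP

/-! ### Finite-horizon values as a function of the terminal value -/

section HorizonValue

open Filter Topology

variable {S A : Type*} [Fintype S] [Fintype A] {M : MDP S A} {G : Set S}

variable (M G) in
/-- The maximal expected reward within `k` steps, if `1` is earned in `G` and `v` for being in
`S_?` at the end. -/
noncomputable def horizonValue (k : ℕ) (v : ℝ) : S → ℝ :=
  (M.bellman (M.unknownStates G) (G.indicator 1))^[k]
    fun s => G.indicator 1 s + (M.unknownStates G : Set S).indicator 1 s * v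

theorem indicator_of_mem_unknownStates {s : S} (hs : s ∈ M.unknownStates G) :
    G.indicator (1 : S → ℝ) s = 0 :=
  Set.indicator_of_notMem (mem_unknownStates.1 hs).2 _

theorem indicator_add_of_mem {s : S} (hs : s ∈ M.unknownStates G) (v : ℝ) :
    G.indicator 1 s + (M.unknownStates G : Set S).indicator 1 s * v = v := by
  rw [indicator_of_mem_unknownStates hs, Set.indicator_of_mem (Finset.mem_coe.2 hs)]
  simp

theorem indicator_add_of_notMem {s : S} (hs : s ∉ M.unknownStates G) (v : ℝ) :
    G.indicator 1 s + (M.unknownStates G : Set S).indicator 1 s * v = G.indicator 1 s := by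
  rw [Set.indicator_of_notMem (s := (M.unknownStates G : Set S)) (by simpa using hs)]
  simp

theorem horizonValue_succ (k : ℕ) (v : ℝ) :
    M.horizonValue G (k + 1) v =
      M.bellman (M.unknownStates G) (G.indicator 1) (M.horizonValue G k v) :=
  Function.iterate_succ_apply' _ _ _

theorem horizonValue_of_notMem {s : S} (hs : s ∉ M.unknownStates G) (k : ℕ) (v : ℝ) :
    M.horizonValue G k v s = G.indicator 1 s := by
  cases k with
  | zero => exact indicator_add_of_notMem hs v
  | succ k => rw [horizonValue_succ, bellman_of_notMem (by simpa using hs)]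

theorem maxReachProb_le_horizonValue (hG : ∀ s ∈ G, M.IsAbsorbing s) {v : ℝ}
    (hv : ∀ s ∈ M.unknownStates G, M.maxReachProb s G ≤ v) (k : ℕ) (s : S) :
    M.maxReachProb s G ≤ M.horizonValue G k v s := by
  refine le_iterate_bellman (g := fun s => M.maxReachProb s G) (fun s => ?_)
    (bellman_unknownStates_maxReachProb hG).ge k s
  by_cases hs : s ∈ M.unknownStates G
  · exact (hv s hs).trans (indicator_add_of_mem hs v).ge
  · exact (maxReachProb_of_notMem_unknownStates hG hs).le.trans (indicator_add_of_notMem hs v).ge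

theorem horizonValue_le_maxReachProb (hG : ∀ s ∈ G, M.IsAbsorbing s) {v : ℝ}
    (hv : ∀ s ∈ M.unknownStates G, v ≤ M.maxReachProb s G) (k : ℕ) (s : S) :
    M.horizonValue G k v s ≤ M.maxReachProb s G := by
  refine iterate_bellman_le (g := fun s => M.maxReachProb s G) (fun s => ?_)
    (bellman_unknownStates_maxReachProb hG).le k s
  by_cases hs : s ∈ M.unknownStates G
  · exact (indicator_add_of_mem hs v).le.trans (hv s hs)
  · exact (indicator_add_of_notMem hs v).le.trans (maxReachProb_of_notMem_unknownStates hG hs).ge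

/-- A lower bound that is reproduced by `k` steps is a lower bound of the maximal reachability
probabilities. -/
theorem le_maxReachProb_of_le_horizonValue (hG : ∀ s ∈ G, M.IsAbsorbing s)
    (hM : M.IsContracting (G ∪ M.zeroStates G)) {k : ℕ} (hk : 0 < k) {m : ℝ}
    (hm : ∀ s ∈ M.unknownStates G, m ≤ M.horizonValue G k m s) :
    ∀ s ∈ M.unknownStates G, m ≤ M.maxReachProb s G := by
  intro s hs
  set Φ := M.bellman (M.unknownStates G) (G.indicator 1)
  set f : S → ℝ := fun s => G.indicator 1 s + (M.unknownStates G : Set S).indicator 1 s * m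
  have hstep : f ≤ Φ^[k] f := by
    intro s
    by_cases hs : s ∈ M.unknownStates G
    · exact (indicator_add_of_mem hs m).le.trans (hm s hs)
    · exact (indicator_add_of_notMem hs m).le.trans (horizonValue_of_notMem hs k m).ge
  -- Since `V ≥ 0`, the slack `|m|` on `S_?` suffices.
  have hle : f ≤ fun s => M.maxReachProb s G +
      (M.unknownStates G : Set S).indicator 1 s * |m| := by
    intro s
    by_cases hs : s ∈ M.unknownStates G
    · refine (indicator_add_of_mem hs m).le.trans ?_
      beta_reduce
      rw [Set.indicator_of_mem (Finset.mem_coe.2 hs), Pi.one_apply, one_mul]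
      exact (le_abs_self m).trans (le_add_of_nonneg_left (maxReachProb_nonneg s))
    · refine (indicator_add_of_notMem hs m).le.trans ?_
      beta_reduce
      rw [maxReachProb_of_notMem_unknownStates hG hs, Set.indicator_of_notMem
        (s := (M.unknownStates G : Set S)) (by simpa using hs), zero_mul, add_zero]
  -- Over `n` blocks of `k` steps `f` can only grow, `V` is fixed, and the slack is damped by the
  -- stay probability.
  have hn : ∀ n, f s ≤ M.maxReachProb s G + M.maxStayProb G (k * n) s * |m| := by
    intro n
    have h1 : f ≤ Φ^[k * n] f := by
      rw [Function.iterate_mul]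
      exact (bellman_mono.iterate k).monotone_iterate_of_le_map hstep (zero_le (a := n))
    have h2 := h1.trans ((bellman_mono.iterate (k * n) hle).trans
      (iterate_bellman_add_mul_le (abs_nonneg m) (k * n))) s
    rw [Function.iterate_fixed (bellman_unknownStates_maxReachProb hG)] at h2
    exact h2
  have hlim : Tendsto (fun n => M.maxReachProb s G + M.maxStayProb G (k * n) s * |m|) atTop
      (𝓝 (M.maxReachProb s G + 0 * |m|)) :=
    tendsto_const_nhds.add (((tendsto_maxStayProb hG hM s).comp
      (tendsto_atTop_mono (fun n => Nat.le_mul_of_pos_left n hk) tendsto_id)).mul_const _)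
  have h3 := ge_of_tendsto' hlim hn
  rw [zero_mul, add_zero] at h3
  exact (indicator_add_of_mem hs m).ge.trans h3

end HorizonValue

/-! ### Action selection and decision values -/

section Actions

variable {S A : Type*} [Fintype S] {M : MDP S A} {x y : S → ℝ} {s : S} {a : A}

theorem mem_Act_of_mem_findAction {u : EReal} (ha : a ∈ M.findAction x y s u) : a ∈ M.Act s := by
  unfold findAction at ha
  split_ifs at ha
  · exact ha.1
  · exact ha.1.1

theorem argmax_nonempty {A : Type*} [Finite A] {T : Set A} (hT : T.Nonempty) (f : A → ℝ) :
    (argmax T f).Nonempty := by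
  obtain ⟨a, ha, h⟩ := Set.exists_max_image T f T.toFinite hT
  exact ⟨a, ha, h⟩

theorem findAction_nonempty [Finite A] (x y : S → ℝ) (s : S) (u : EReal) :
    (M.findAction x y s u).Nonempty := by
  unfold findAction
  split_ifs
  · exact argmax_nonempty (M.exists_enabled s) _
  · exact argmax_nonempty (argmax_nonempty (M.exists_enabled s) _) _

theorem exitCond_of_y_eq_zero {c : Vars S} {ε : ℝ} (hε : 0 < ε) (h : c.y M.init = 0) : M.ExitCond ε c := by
  rw [ExitCond, h, EReal.coe_zero, zero_mul]
  exact_mod_cast (by linarith : (0 : ℝ) < 2 * ε)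

theorem output_of_y_eq_zero {c : Vars S} (h : c.y M.init = 0) : M.output c = c.x M.init := by
  rw [output, h, EReal.coe_zero, zero_mul, add_zero]

variable [Fintype A]

/-- The quotient is where the lines `v ↦ E x + v E y` of `a` and `b` cross: if `a` is steeper, it is
at least as good as `b` exactly from there on. Strictness of the slope inequality already excludes
`b = a`. -/
theorem decisionValue_le_iff {c : EReal} :
    M.decisionValue x y s a ≤ c ↔ ∀ b ∈ M.Act s, M.expect s b y < M.expect s a y →
      (((M.expect s b x - M.expect s a x) / (M.expect s a y - M.expect s b y) : ℝ) : EReal) ≤ c := by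
  have key : ∀ (a b : A) (z : S → ℝ), ∑ s', (M.P s a s' - M.P s b s') * z s' =
      M.expect s a z - M.expect s b z := fun a b z => by
    simp only [expect, sub_mul, Finset.sum_sub_distrib]
  simp only [decisionValue, key, Finset.sup_le_iff, Finset.mem_filter, Finset.mem_univ, true_and,
    sub_pos]
  refine forall_congr' fun b => ⟨fun h hb hlt => h ⟨hb, ?_, hlt⟩, fun h hb => h hb.1 hb.2.2⟩
  rintro rfl
  exact lt_irrefl _ hlt

theorem decisionValue_lt_top : M.decisionValue x y s a < ⊤ := by
  unfold decisionValue
  exact (Finset.sup_lt_iff bot_lt_top).2 fun b _ => EReal.coe_lt_top _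

/-- The decision value is a lower bound for the values that justify the selected action. -/
theorem decisionValue_le_of_mem_findAction {u : EReal} (hu : u ≠ ⊥)
    (ha : a ∈ M.findAction x y s u) : M.decisionValue x y s a ≤ u := by
  induction u with
  | bot => exact absurd rfl hu
  | top => exact le_top
  | coe u =>
    rw [findAction, if_pos (EReal.coe_ne_top u)] at ha
    refine decisionValue_le_iff.2 fun b hb hlt => EReal.coe_le_coe_iff.2 ?_
    have h := ha.2 b hb
    simp only [EReal.toReal_coe, expect_add_mul] at h
    rw [div_le_iff₀ (sub_pos.2 hlt)]
    linarith

/-- The selected action is optimal for all values between the decision value and `u`. -/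
theorem expect_le_of_mem_findAction {u : EReal} {v : ℝ} (ha : a ∈ M.findAction x y s u)
    (hd : M.decisionValue x y s a ≤ v) (hv : (v : EReal) ≤ u) {b : A} (hb : b ∈ M.Act s) :
    M.expect s b (fun s' => x s' + y s' * v) ≤ M.expect s a (fun s' => x s' + y s' * v) := by
  simp only [expect_add_mul]
  -- Flatter competitors are handled by the decision value. Against the others the advantage of `a`
  -- at `u` cannot shrink as `v` decreases; for `u = ⊤` the slope of `a` is maximal, so the slopes
  -- agree and the tie-break on `x` decides.
  rcases lt_or_ge (M.expect s b y) (M.expect s a y) with hlt | hge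
  · have h := EReal.coe_le_coe_iff.1 (decisionValue_le_iff.1 hd b hb hlt)
    rw [div_le_iff₀ (sub_pos.2 hlt)] at h
    linarith
  · induction u with
    | bot => exact absurd hv (not_le.2 (EReal.bot_lt_coe v))
    | top =>
      rw [findAction, if_neg (by simp)] at ha
      have hxb := ha.2 b ⟨hb, fun c hc => (ha.1.2 c hc).trans hge⟩
      rw [le_antisymm hge (ha.1.2 b hb)]
      linarith
    | coe u =>
      rw [findAction, if_pos (EReal.coe_ne_top u)] at ha
      have h := ha.2 b hb
      simp only [EReal.toReal_coe, expect_add_mul] at h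
      have h1 := mul_le_mul_of_nonneg_left (EReal.coe_le_coe_iff.1 hv) (sub_nonneg.2 hge)
      linarith

end Actions

/-! ### Loop invariant, correctness of the output, termination -/

section Invariant

open Filter Topology

variable {S A : Type*} [Fintype S] [Fintype A] {M : MDP S A} {G : Set S}

variable (M G) in
/-- The invariant of the loop after `k` iterations. -/
structure Invariant (k : ℕ) (c : Vars S) : Prop where
  x_of_notMem : ∀ s ∉ M.unknownStates G, c.x s = G.indicator 1 s
  y_of_notMem : ∀ s ∉ M.unknownStates G, c.y s = 0
  y_nonneg : 0 ≤ c.y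
  y_le : c.y ≤ M.maxStayProb G k
  le_value : ∀ v s, c.x s + c.y s * v ≤ M.horizonValue G k v s
  value_le : ∀ v : ℝ, c.d ≤ v → v ≤ c.u → ∀ s, M.horizonValue G k v s ≤ c.x s + c.y s * v
  d_le_u : c.d ≤ c.u
  d_lt_top : c.d < ⊤
  le_u : ∀ s ∈ M.unknownStates G, (M.maxReachProb s G : EReal) ≤ c.u
  l_le : ∀ s ∈ M.unknownStates G, c.l ≤ M.maxReachProb s G
  -- One-sided on purpose: for empty `S_?` the computed bounds are `l = ⊤` and `u = ⊥`. Given a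
  -- state in `S_?`, `l_le` and `le_u` supply the other sides.
  bounds : c.l = ⊥ ∧ c.u = ⊤ ∨ ⊥ < c.l ∧ c.u < ⊤

theorem initVars_x : (M.initVars G).x = G.indicator 1 := by
  classical
  funext s
  simp [initVars, Set.indicator_apply]

theorem initVars_y : (M.initVars G).y = (M.unknownStates G : Set S).indicator 1 := by
  classical
  funext s
  simp [initVars, Set.indicator_apply]

theorem invariant_initVars : M.Invariant G 0 (M.initVars G) where
  x_of_notMem s _ := by rw [initVars_x]
  y_of_notMem s hs := by rw [initVars_y, Set.indicator_of_notMem (by simpa using hs)]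
  y_nonneg := by
    rw [initVars_y]
    exact fun s => Set.indicator_nonneg (fun _ _ => zero_le_one) s
  y_le := initVars_y.le
  le_value v s := by rw [initVars_x, initVars_y]; exact le_rfl
  value_le v _ _ s := by rw [initVars_x, initVars_y]; exact le_rfl
  d_le_u := bot_le
  d_lt_top := bot_lt_top
  le_u _ _ := le_top
  l_le _ _ := bot_le
  bounds := Or.inl ⟨rfl, rfl⟩

theorem updateX_of_mem {s : S} (hs : s ∈ M.unknownStates G) (x : S → ℝ) (α : S → A) :
    M.updateX G x α s = M.expect s (α s) x := by
  rw [updateX, if_neg (mem_unknownStates.1 hs).2, if_pos hs]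

theorem updateX_of_notMem {s : S} (hs : s ∉ M.unknownStates G) (x : S → ℝ) (α : S → A) :
    M.updateX G x α s = G.indicator 1 s := by
  classical
  rw [updateX, if_neg hs, Set.indicator_apply, Pi.one_apply]

theorem updateY_of_mem {s : S} (hs : s ∈ M.unknownStates G) (y : S → ℝ) (α : S → A) :
    M.updateY G y α s = M.expect s (α s) y := if_pos hs

theorem updateY_of_notMem {s : S} (hs : s ∉ M.unknownStates G) (y : S → ℝ) (α : S → A) :
    M.updateY G y α s = 0 := if_neg hs

theorem iterate_x (c : Vars S) (α : S → A) : (M.iterate G c α).x = M.updateX G c.x α := by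
  simp only [iterate]; split_ifs <;> rfl

theorem iterate_y (c : Vars S) (α : S → A) : (M.iterate G c α).y = M.updateY G c.y α := by
  simp only [iterate]; split_ifs <;> rfl

theorem iterate_d (c : Vars S) (α : S → A) : (M.iterate G c α).d = M.updateD G c α := by
  simp only [iterate]; split_ifs <;> rfl

variable (M G) in
/-- The bound on the probabilities for the state `s` that is computed from `x` and `y`. -/
noncomputable def ratio (c : Vars S) (α : S → A) (s : S) : EReal :=
  ((M.updateX G c.x α s / (1 - M.updateY G c.y α s) : ℝ) : EReal)

theorem iterate_l (c : Vars S) (α : S → A)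
    (h : ∀ s ∈ M.unknownStates G, M.updateY G c.y α s < 1) :
    (M.iterate G c α).l = max c.l ((M.unknownStates G).inf (M.ratio G c α)) := by
  simp only [iterate, if_pos h]; rfl

theorem iterate_u (c : Vars S) (α : S → A)
    (h : ∀ s ∈ M.unknownStates G, M.updateY G c.y α s < 1) :
    (M.iterate G c α).u =
      min c.u (max (M.updateD G c α) ((M.unknownStates G).sup (M.ratio G c α))) := by
  simp only [iterate, if_pos h]; rfl

theorem iterate_l_of_not (c : Vars S) (α : S → A)
    (h : ¬ ∀ s ∈ M.unknownStates G, M.updateY G c.y α s < 1) : (M.iterate G c α).l = c.l := by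
  simp only [iterate, if_neg h]

theorem iterate_u_of_not (c : Vars S) (α : S → A)
    (h : ¬ ∀ s ∈ M.unknownStates G, M.updateY G c.y α s < 1) : (M.iterate G c α).u = c.u := by
  simp only [iterate, if_neg h]

theorem le_iterate_l (c : Vars S) (α : S → A) : c.l ≤ (M.iterate G c α).l := by
  by_cases h : ∀ s ∈ M.unknownStates G, M.updateY G c.y α s < 1
  · rw [iterate_l c α h]; exact le_max_left _ _
  · rw [iterate_l_of_not c α h]

theorem iterate_u_le (c : Vars S) (α : S → A) : (M.iterate G c α).u ≤ c.u := by
  by_cases h : ∀ s ∈ M.unknownStates G, M.updateY G c.y α s < 1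
  · rw [iterate_u c α h]; exact min_le_left _ _
  · rw [iterate_u_of_not c α h]

variable {k : ℕ} {c : Vars S} {α : S → A}

theorem updateX_add_updateY_le (hc : M.Invariant G k c)
    (hα : ∀ s ∈ M.unknownStates G, α s ∈ M.Act s) (v : ℝ) (s : S) :
    M.updateX G c.x α s + M.updateY G c.y α s * v ≤ M.horizonValue G (k + 1) v s := by
  by_cases hs : s ∈ M.unknownStates G
  · rw [updateX_of_mem hs, updateY_of_mem hs, ← expect_add_mul, horizonValue_succ]
    exact (M.expect_mono fun s => hc.le_value v s).trans
      (expect_le_bellman (Finset.mem_coe.2 hs) (hα s hs))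
  · rw [updateX_of_notMem hs, updateY_of_notMem hs, horizonValue_of_notMem hs, zero_mul, add_zero]

/-- For all such `v` simultaneously the chosen actions attain the maximum in the Bellman operator,
so a single pair of vectors represents the optimum on the whole interval. -/
theorem le_updateX_add_updateY (hc : M.Invariant G k c)
    (hα : ∀ s ∈ M.unknownStates G, α s ∈ M.findAction c.x c.y s c.u) {v : ℝ}
    (hd : M.updateD G c α ≤ v) (hv : (v : EReal) ≤ c.u) (s : S) :
    M.horizonValue G (k + 1) v s ≤ M.updateX G c.x α s + M.updateY G c.y α s * v := by
  by_cases hs : s ∈ M.unknownStates G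
  · rw [updateX_of_mem hs, updateY_of_mem hs, ← expect_add_mul, horizonValue_succ]
    obtain ⟨b, hb, h⟩ := exists_bellman_eq (M := M) (G.indicator 1) (M.horizonValue G k v)
      (Finset.mem_coe.2 hs)
    rw [h]
    refine (M.expect_mono fun s => hc.value_le v ((le_max_left _ _).trans hd) hv s).trans ?_
    refine expect_le_of_mem_findAction (hα s hs) (le_trans ?_ hd) hv hb
    exact (Finset.le_sup (f := fun s => M.decisionValue c.x c.y s (α s)) hs).trans
      (le_max_right _ _)
  · rw [updateX_of_notMem hs, updateY_of_notMem hs, horizonValue_of_notMem hs, zero_mul, add_zero]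

/-- At a state `t` of maximal probability `v`, either `v` is below the decision value, or `v ≤ x t +
y t * v`, which solves to the ratio at `t`. -/
theorem maxReachProb_le_max_sup_ratio (hG : ∀ s ∈ G, M.IsAbsorbing s) (hc : M.Invariant G k c)
    (hα : ∀ s ∈ M.unknownStates G, α s ∈ M.findAction c.x c.y s c.u)
    (hy : ∀ s ∈ M.unknownStates G, M.updateY G c.y α s < 1) {s : S}
    (hs : s ∈ M.unknownStates G) :
    (M.maxReachProb s G : EReal) ≤
      max (M.updateD G c α) ((M.unknownStates G).sup (M.ratio G c α)) := by
  obtain ⟨t, ht, hmax⟩ := Finset.exists_max_image (M.unknownStates G)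
    (fun s => M.maxReachProb s G) ⟨s, hs⟩
  refine (EReal.coe_le_coe_iff.2 (hmax s hs)).trans ?_
  rcases le_total (M.updateD G c α) (M.maxReachProb t G) with hd | hd
  · refine le_trans ?_ (le_max_right _ _)
    refine le_trans ?_ (Finset.le_sup (f := M.ratio G c α) ht)
    refine EReal.coe_le_coe_iff.2 ?_
    have h := (maxReachProb_le_horizonValue hG hmax (k + 1) t).trans
      (le_updateX_add_updateY hc hα hd (hc.le_u t ht) t)
    rw [le_div_iff₀ (sub_pos.2 (hy t ht))]
    linarith
  · exact hd.trans (le_max_left _ _)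

/-- The least ratio `m` satisfies `m ≤ x + y * m` throughout `S_?`, so `k + 1` steps reproduce it.
-/
theorem inf_ratio_le_maxReachProb (hG : ∀ s ∈ G, M.IsAbsorbing s)
    (hM : M.IsContracting (G ∪ M.zeroStates G)) (hc : M.Invariant G k c)
    (hα : ∀ s ∈ M.unknownStates G, α s ∈ M.Act s)
    (hy : ∀ s ∈ M.unknownStates G, M.updateY G c.y α s < 1) {s : S}
    (hs : s ∈ M.unknownStates G) :
    (M.unknownStates G).inf (M.ratio G c α) ≤ M.maxReachProb s G := by
  obtain ⟨t, ht, hmin⟩ := Finset.exists_min_image (M.unknownStates G)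
    (fun s => M.updateX G c.x α s / (1 - M.updateY G c.y α s)) ⟨s, hs⟩
  refine (Finset.inf_le (f := M.ratio G c α) ht).trans (EReal.coe_le_coe_iff.2 ?_)
  refine le_maxReachProb_of_le_horizonValue hG hM k.succ_pos (fun r hr => ?_) s hs
  refine le_trans ?_ (updateX_add_updateY_le hc hα _ r)
  have h := hmin r hr
  rw [le_div_iff₀ (sub_pos.2 (hy r hr))] at h
  linarith

theorem Invariant.updateD_lt_top (hc : M.Invariant G k c) (α : S → A) :
    M.updateD G c α < ⊤ :=
  max_lt hc.d_lt_top ((Finset.sup_lt_iff bot_lt_top).2 fun _ _ => decisionValue_lt_top)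

theorem Invariant.bounds_iterate (hc : M.Invariant G k c)
    (hy : ∀ s ∈ M.unknownStates G, M.updateY G c.y α s < 1) :
    ⊥ < (M.iterate G c α).l ∧ (M.iterate G c α).u < ⊤ := by
  rw [iterate_l c α hy, iterate_u c α hy]
  refine ⟨lt_max_of_lt_right ?_, min_lt_of_right_lt (max_lt (hc.updateD_lt_top α) ?_)⟩
  · exact (Finset.lt_inf_iff bot_lt_top).2 fun _ _ => EReal.bot_lt_coe _
  · exact (Finset.sup_lt_iff bot_lt_top).2 fun _ _ => EReal.coe_lt_top _

theorem Invariant.iterate (hG : ∀ s ∈ G, M.IsAbsorbing s)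
    (hM : M.IsContracting (G ∪ M.zeroStates G)) (hc : M.Invariant G k c)
    (hα : ∀ s ∈ M.unknownStates G, α s ∈ M.findAction c.x c.y s c.u) :
    M.Invariant G (k + 1) (M.iterate G c α) := by
  have hact : ∀ s ∈ M.unknownStates G, α s ∈ M.Act s := fun s hs =>
    mem_Act_of_mem_findAction (hα s hs)
  -- An upper bound of a probability is not `⊥`, so the chosen actions are optimal at `u` and their
  -- crossing points lie below it.
  have hdec : ∀ s ∈ M.unknownStates G, M.decisionValue c.x c.y s (α s) ≤ c.u := fun s hs =>
    decisionValue_le_of_mem_findAction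
      ((EReal.bot_lt_coe _).trans_le (hc.le_u s hs)).ne' (hα s hs)
  have hdu : M.updateD G c α ≤ c.u := max_le hc.d_le_u (Finset.sup_le hdec)
  refine ⟨fun s hs => ?_, fun s hs => ?_, fun s => ?_, fun s => ?_, fun v s => ?_,
    fun v hd hv s => ?_, ?_, ?_, fun s hs => ?_, fun s hs => ?_, ?_⟩
  · rw [iterate_x, updateX_of_notMem hs]
  · rw [iterate_y, updateY_of_notMem hs]
  · rw [iterate_y]
    by_cases hs : s ∈ M.unknownStates G
    · rw [updateY_of_mem hs]
      exact M.expect_nonneg hc.y_nonneg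
    · rw [updateY_of_notMem hs, Pi.zero_apply]
  · rw [iterate_y]
    by_cases hs : s ∈ M.unknownStates G
    · rw [updateY_of_mem hs, maxStayProb, Function.iterate_succ_apply']
      exact (M.expect_mono hc.y_le).trans (expect_le_bellman (Finset.mem_coe.2 hs) (hact s hs))
    · rw [updateY_of_notMem hs]
      exact maxStayProb_nonneg _ s
  · rw [iterate_x, iterate_y]
    exact updateX_add_updateY_le hc hact v s
  · rw [iterate_x, iterate_y]
    rw [iterate_d] at hd
    exact le_updateX_add_updateY hc hα hd (hv.trans (iterate_u_le c α)) s
  · rw [iterate_d]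
    by_cases hy : ∀ s ∈ M.unknownStates G, M.updateY G c.y α s < 1
    · rw [iterate_u c α hy]
      exact le_min hdu (le_max_left _ _)
    · rwa [iterate_u_of_not c α hy]
  · rw [iterate_d]
    exact hc.updateD_lt_top α
  · by_cases hy : ∀ s ∈ M.unknownStates G, M.updateY G c.y α s < 1
    · rw [iterate_u c α hy]
      exact le_min (hc.le_u s hs) (maxReachProb_le_max_sup_ratio hG hc hα hy hs)
    · rw [iterate_u_of_not c α hy]
      exact hc.le_u s hs
  · by_cases hy : ∀ s ∈ M.unknownStates G, M.updateY G c.y α s < 1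
    · rw [iterate_l c α hy]
      exact max_le (hc.l_le s hs) (inf_ratio_le_maxReachProb hG hM hc hact hy hs)
    · rw [iterate_l_of_not c α hy]
      exact hc.l_le s hs
  · by_cases hy : ∀ s ∈ M.unknownStates G, M.updateY G c.y α s < 1
    · exact Or.inr (hc.bounds_iterate hy)
    · rw [iterate_l_of_not c α hy, iterate_u_of_not c α hy]
      exact hc.bounds

theorem Invariant.of_body (hG : ∀ s ∈ G, M.IsAbsorbing s)
    (hM : M.IsContracting (G ∪ M.zeroStates G)) (hc : M.Invariant G k c) {c' : Vars S}
    (h : M.Body G c c') : M.Invariant G (k + 1) c' := by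
  obtain ⟨α, hα, rfl⟩ := h
  exact hc.iterate hG hM hα

theorem exists_body (c : Vars S) : ∃ c', M.Body G c c' :=
  ⟨_, fun s => (findAction_nonempty (M := M) c.x c.y s c.u).choose,
    fun s _ => (findAction_nonempty (M := M) c.x c.y s c.u).choose_spec, rfl⟩

/-- The bounds are finite as soon as `S_?` is left with positive probability. -/
theorem Invariant.bounds_of_body (hc : M.Invariant G k c) {c' : Vars S}
    (h : M.Body G c c') (hp : ∀ s, M.maxStayProb G (k + 1) s < 1) : ⊥ < c'.l ∧ c'.u < ⊤ := by
  obtain ⟨α, hα, rfl⟩ := h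
  have hy : ∀ s ∈ M.unknownStates G, M.updateY G c.y α s < 1 := by
    intro s hs
    refine lt_of_le_of_lt ?_ (hp s)
    rw [updateY_of_mem hs, maxStayProb, Function.iterate_succ_apply']
    exact (M.expect_mono hc.y_le).trans
      (expect_le_bellman (Finset.mem_coe.2 hs) (mem_Act_of_mem_findAction (hα s hs)))
  exact hc.bounds_iterate hy

theorem Invariant.exists_u_eq_coe (hc : M.Invariant G k c) {s : S} (hs : s ∈ M.unknownStates G)
    (h : c.u < ⊤) : ∃ u : ℝ, c.u = u :=
  ⟨c.u.toReal, (EReal.coe_toReal h.ne ((EReal.bot_lt_coe _).trans_le (hc.le_u s hs)).ne').symm⟩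

theorem Invariant.exists_l_eq_coe (hc : M.Invariant G k c) {s : S} (hs : s ∈ M.unknownStates G)
    (h : ⊥ < c.l) : ∃ l : ℝ, c.l = l :=
  ⟨c.l.toReal, (EReal.coe_toReal ((hc.l_le s hs).trans_lt (EReal.coe_lt_top _)).ne h.ne').symm⟩

/-- If `y` vanishes at a state, `x` is exact there. -/
theorem Invariant.x_eq_of_y_eq_zero (hG : ∀ s ∈ G, M.IsAbsorbing s) (hc : M.Invariant G k c)
    {s : S} (hy : c.y s = 0) : c.x s = M.maxReachProb s G := by
  by_cases hs : s ∈ M.unknownStates G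
  · refine le_antisymm ?_ ?_
    · have h1 := hc.le_value 0 s
      rw [hy, zero_mul, add_zero] at h1
      exact h1.trans (horizonValue_le_maxReachProb hG (fun s _ => maxReachProb_nonneg s) k s)
    -- Any `v` in `[d, u]` that dominates `V` on `S_?` will do: `u` itself if finite, otherwise a
    -- large enough real number.
    · obtain ⟨v, hdv, hvu, hv⟩ : ∃ v : ℝ, c.d ≤ v ∧ (v : EReal) ≤ c.u ∧
          ∀ s ∈ M.unknownStates G, M.maxReachProb s G ≤ v := by
        rcases hc.bounds with ⟨-, hu⟩ | ⟨-, hu⟩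
        · refine ⟨max c.d.toReal 1, (EReal.le_coe_toReal hc.d_lt_top.ne).trans
            (EReal.coe_le_coe_iff.2 (le_max_left _ _)), hu ▸ le_top, fun s _ =>
            (maxReachProb_le_one s).trans (le_max_right _ _)⟩
        · obtain ⟨u, hu'⟩ := hc.exists_u_eq_coe hs hu
          refine ⟨u, hu' ▸ hc.d_le_u, hu'.ge, fun s hs => EReal.coe_le_coe_iff.1 ?_⟩
          exact (hc.le_u s hs).trans hu'.le
      have h1 := (maxReachProb_le_horizonValue hG hv k s).trans (hc.value_le v hdv hvu s)
      rwa [hy, zero_mul, add_zero] at h1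
  · rw [hc.x_of_notMem s hs, maxReachProb_of_notMem_unknownStates hG hs]

/-- The value that is returned is correct. -/
theorem Invariant.output_spec (hG : ∀ s ∈ G, M.IsAbsorbing s) (hc : M.Invariant G k c) {ε : ℝ}
    (hε : 0 < ε) (h : M.ExitCond ε c) :
    ∃ r : ℝ, M.output c = r ∧ |r - M.maxReachProb M.init G| ≤ ε := by
  by_cases hy : c.y M.init = 0
  · refine ⟨_, output_of_y_eq_zero hy, ?_⟩
    rw [hc.x_eq_of_y_eq_zero hG hy, sub_self, abs_zero]
    exact hε.le
  have hs : M.init ∈ M.unknownStates G := by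
    by_contra hs
    exact hy (hc.y_of_notMem _ hs)
  have hpos : 0 < c.y M.init := lt_of_le_of_ne (hc.y_nonneg _) (Ne.symm hy)
  rcases hc.bounds with ⟨hl, hu⟩ | ⟨hl, hu⟩
  -- With infinite bounds and `y > 0` the product is `⊤`, so the loop cannot have been left.
  · rw [ExitCond, hl, hu, EReal.top_sub_bot, EReal.coe_mul_top_of_pos hpos] at h
    exact absurd h not_top_lt
  obtain ⟨u, hu⟩ := hc.exists_u_eq_coe hs hu
  obtain ⟨l, hl⟩ := hc.exists_l_eq_coe hs hl
  have hVu : ∀ s ∈ M.unknownStates G, M.maxReachProb s G ≤ u := fun s hs =>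
    EReal.coe_le_coe_iff.1 (hu ▸ hc.le_u s hs)
  have hVl : ∀ s ∈ M.unknownStates G, l ≤ M.maxReachProb s G := fun s hs =>
    EReal.coe_le_coe_iff.1 (hl ▸ hc.l_le s hs)
  -- Evaluating at `v = u` and `v = l` encloses the true value in an interval of length `y * (u -
  -- l)`.
  have h1 := (maxReachProb_le_horizonValue hG hVu k M.init).trans
    (hc.value_le u (hu ▸ hc.d_le_u) hu.ge M.init)
  have h2 := (hc.le_value l M.init).trans (horizonValue_le_maxReachProb hG hVl k M.init)
  rw [ExitCond, hl, hu, ← EReal.coe_sub, ← EReal.coe_mul, EReal.coe_lt_coe_iff] at h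
  refine ⟨c.x M.init + c.y M.init * ((l + u) / 2), ?_, ?_⟩
  · rw [output, hl, hu]
    push_cast
    rfl
  · rw [abs_le]
    constructor <;> linarith

/-- The exit condition holds eventually. -/
theorem exists_exitCond (hG : ∀ s ∈ G, M.IsAbsorbing s)
    (hM : M.IsContracting (G ∪ M.zeroStates G)) {ε : ℝ} (hε : 0 < ε) (C : ℕ → Vars S)
    (h0 : C 0 = M.initVars G) (hC : ∀ n, M.Body G (C n) (C (n + 1))) :
    ∃ n, M.ExitCond ε (C (n + 1)) := by
  have hinv : ∀ n, M.Invariant G n (C n) := by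
    intro n
    induction n with
    | zero => exact h0 ▸ invariant_initVars
    | succ n ih => exact ih.of_body hG hM (hC n)
  by_cases hs : M.init ∈ M.unknownStates G
  swap
  · exact ⟨0, exitCond_of_y_eq_zero hε ((hinv 1).y_of_notMem _ hs)⟩
  have hev : ∀ᶠ n in atTop, ∀ s, M.maxStayProb G n s < 1 :=
    eventually_all.2 fun s => (tendsto_maxStayProb hG hM s).eventually_lt_const zero_lt_one
  obtain ⟨N, hN⟩ := eventually_atTop.1 hev
  -- From here on the width is at most the fixed real number `u - l`, and only `y` has to become
  -- small.
  obtain ⟨hl, hu⟩ := (hinv N).bounds_of_body (hC N) (hN _ N.le_succ)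
  obtain ⟨u, hu⟩ := (hinv (N + 1)).exists_u_eq_coe hs hu
  obtain ⟨l, hl⟩ := (hinv (N + 1)).exists_l_eq_coe hs hl
  have hmono : ∀ n, N + 1 ≤ n → (l : EReal) ≤ (C n).l ∧ (C n).u ≤ u := by
    intro n hn
    induction n, hn using Nat.le_induction with
    | base => exact ⟨hl.ge, hu.le⟩
    | succ n _ ih =>
      obtain ⟨α, -, h⟩ := hC n
      rw [h]
      exact ⟨ih.1.trans (le_iterate_l _ _), (iterate_u_le _ _).trans ih.2⟩
  have hlim : Tendsto (fun n => M.maxStayProb G n M.init * (u - l)) atTop (𝓝 (0 * (u - l))) :=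
    (tendsto_maxStayProb hG hM M.init).mul_const _
  rw [zero_mul] at hlim
  obtain ⟨n, hn, hsmall⟩ := ((eventually_ge_atTop N).and ((tendsto_add_atTop_iff_nat 1).2
    hlim |>.eventually_lt_const (by linarith : 0 < 2 * ε))).exists
  refine ⟨n, ?_⟩
  obtain ⟨hln, hun⟩ := hmono (n + 1) (Nat.succ_le_succ hn)
  have hI := hinv (n + 1)
  obtain ⟨u', hu'⟩ := hI.exists_u_eq_coe hs (hun.trans_lt (EReal.coe_lt_top _))
  obtain ⟨l', hl'⟩ := hI.exists_l_eq_coe hs ((EReal.bot_lt_coe _).trans_le hln)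
  rw [hl', EReal.coe_le_coe_iff] at hln
  rw [hu', EReal.coe_le_coe_iff] at hun
  have hlu : l ≤ u := by
    have h := ((hinv (N + 1)).l_le _ hs).trans ((hinv (N + 1)).le_u _ hs)
    rwa [hl, hu, EReal.coe_le_coe_iff] at h
  rw [ExitCond, hl', hu', ← EReal.coe_sub, ← EReal.coe_mul, EReal.coe_lt_coe_iff]
  refine lt_of_le_of_lt ?_ hsmall
  exact (mul_le_mul_of_nonneg_left (by linarith) (hI.y_nonneg _)).trans
    (mul_le_mul_of_nonneg_right (hI.y_le _) (sub_nonneg.2 hlu))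

theorem reachable_config (hG : ∀ s ∈ G, M.IsAbsorbing s)
    (hM : M.IsContracting (G ∪ M.zeroStates G)) {ε : ℝ} {f : Config S}
    (h : Relation.ReflTransGen (M.Step G ε) (Config.running (M.initVars G)) f) :
    (∃ k c, M.Invariant G k c ∧ f = Config.running c) ∨
      ∃ k c, M.Invariant G k c ∧ M.ExitCond ε c ∧ f = Config.returned (M.output c) := by
  induction h with
  | refl => exact Or.inl ⟨0, _, invariant_initVars, rfl⟩
  | tail _ hstep ih =>
    cases hstep with
    | loop c c' hb _ =>
      rcases ih with ⟨k, c₀, hc, h⟩ | ⟨k, c₀, -, -, h⟩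
      · cases h
        exact Or.inl ⟨k + 1, c', hc.of_body hG hM hb, rfl⟩
      · cases h
    | exit c c' hb he =>
      rcases ih with ⟨k, c₀, hc, h⟩ | ⟨k, c₀, -, -, h⟩
      · cases h
        exact Or.inr ⟨k + 1, c', hc.of_body hG hM hb, he, rfl⟩
      · cases h

end Invariant

end MDP

theorem theorem5 {S A : Type*} [Fintype S] [Fintype A] (M : MDP S A) (G : Set S)
    (hG : ∀ s ∈ G, M.IsAbsorbing s) (hM : M.IsContracting (G ∪ M.zeroStates G))
    (ε : ℝ) (hε : 0 < ε) :
    (¬ ∃ e : ℕ → MDP.Config S, e 0 = MDP.Config.running (M.initVars G) ∧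
      ∀ n, M.Step G ε (e n) (e (n + 1))) ∧
    ∀ f : MDP.Config S,
      Relation.ReflTransGen (M.Step G ε) (MDP.Config.running (M.initVars G)) f →
      (¬ ∃ f', M.Step G ε f f') →
      ∃ r : ℝ, f = MDP.Config.returned (r : EReal) ∧ |r - M.maxReachProb M.init G| ≤ ε := by
  constructor
  · rintro ⟨e, h0, he⟩
    -- A returned configuration has no successor, so an infinite run never exits.
    have hrun : ∀ n, ∃ c, e n = MDP.Config.running c := by
      intro n
      have h := he n
      generalize e n = a, e (n + 1) = b at h ⊢
      cases h with
      | loop c _ _ _ => exact ⟨c, rfl⟩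
      | exit c _ _ _ => exact ⟨c, rfl⟩
    choose C hC using hrun
    have hstep : ∀ n, M.Body G (C n) (C (n + 1)) ∧ ¬ M.ExitCond ε (C (n + 1)) := by
      intro n
      have h := he n
      rw [hC n, hC (n + 1)] at h
      cases h with
      | loop _ _ hb hx => exact ⟨hb, hx⟩
    have hC0 : C 0 = M.initVars G := by
      have h := (hC 0).symm.trans h0
      injection h
    obtain ⟨n, hn⟩ := MDP.exists_exitCond hG hM hε C hC0 fun n => (hstep n).1
    exact (hstep n).2 hn
  · intro f hf hterm
    rcases MDP.reachable_config hG hM hf with ⟨k, c, -, rfl⟩ | ⟨k, c, hc, hx, rfl⟩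
    -- A running configuration is never stuck, as `findAction` always offers an action.
    · obtain ⟨c', hb⟩ := MDP.exists_body (M := M) (G := G) c
      by_cases hx : M.ExitCond ε c'
      · exact absurd ⟨_, MDP.Step.exit c c' hb hx⟩ hterm
      · exact absurd ⟨_, MDP.Step.loop c c' hb hx⟩ hterm
    · obtain ⟨r, hr, hle⟩ := hc.output_spec hG hε hx
      exact ⟨r, by rw [hr], hle⟩
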